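/- \textbf{Notation.} All Hilbert spaces are complex and finite-dimensional; $\mathbb{S}(\mathcal{H})$ is the unit sphere with its Borel $\sigma$-algebra, $\|f\|_\infty=\sup|f|$, and $\mu(f)=\int f\,d\mu$. A density matrix $\rho$ on $\mathcal{H}$ is a positive operator with $\operatorname{tr}\rho=1$; $\|\rho\|$ is its operator norm. Write $\rho=\sum_n p_n|n\rangle\langle n|$ with an orthonormal eigenbasis $(|n\rangle)$ of $\mathcal{H}$. Let $\mathrm{G}(\rho)$ be the distribution of $\sum_n Z_n|n\rangle$, where the $Z_n$ are independent complex Gaussian variables with mean $0$ and $\mathbb{E}|Z_n|^2=p_n$ (real and imaginary parts independent, each of variance $p_n/2$). Let $\mathrm{GA}(\rho)(d\psi)=\|\psi\|^2\,\mathrm{G}(\rho)(d\psi)$, and let $\mathrm{GAP}(\rho)$ be the distribution on $\mathbb{S}(\mathcal{H})$ of $\Psi/\|\Psi\|$ for $\Psi$ distributed according to $\mathrm{GA}(\rho)$. For $\psi\in\mathbb{S}(\mathcal{H}_a\otimes\mathcal{H}_b)$ and an orthonormal basis $B=(|m\rangle_b)_{m}$ of $\mathcal{H}_b$, let ${}_b\langle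 m|\psi\rangle\in\mathcal{H}_a$ be the partial inner product, let $M$ be a random index with $\mathbb{P}(M=m)=\|{}_b\langle m|\psi\rangle\|^2$, and let $\mathrm{Born}_a^{\psi,B}$ be the distribution on $\mathbb{S}(\mathcal{H}_a)$ of the conditional wave function $\psi_a={}_b\langle M|\psi\rangle/\|{}_b\langle M|\psi\rangle\|$. Let $\mathrm{ONB}(\mathcal{H}_b)$ be the set of orthonormal bases of $\mathcal{H}_b$ and $u_{\mathrm{ONB}}$ the uniform distribution on it, i.e. the distribution of the image of a fixed orthonormal basis under a Haar-distributed random unitary operator. Let $\operatorname{tr}_b$ be the partial trace over $\mathcal{H}_b$. \textbf{Statement.} Let $\varepsilon,\delta\in(0,1)$, let $\mathcal{H}_a$ be a Hilbert space of finite dimension $d_a$, and let $f:\mathbb{S}(\mathcal{H}_a)\to\mathbb{R}$ be continuous. Then there is $p>0$, depending only on $\varepsilon,\delta,\mathcal{H}_a,f$, such that for every Hilbert space $\mathcal{H}_b$ of finite dimension $$d_b\ \geq\ \max\Bigl\{4,\ d_a,\ \frac{32\|f\|_\infty^2}{\varepsilon^2\delta}\Bigr\}$$ and every density matrix $\rho$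 on $\mathcal{H}=\mathcal{H}_a\otimes\mathcal{H}_b$ with $\|\rho\|\leq p$, $$\mathrm{GAP}(\rho)\times u_{\mathrm{ONB}}\Bigl\{(\psi,B)\in\mathbb{S}(\mathcal{H})\times\mathrm{ONB}(\mathcal{H}_b):\ \bigl|\mathrm{Born}_a^{\psi,B}(f)-\mathrm{GAP}(\operatorname{tr}_b\rho)(f)\bigr|<\varepsilon\Bigr\}\ \geq\ 1-\delta .$$ -/

import Mathlib

open MeasureTheory ProbabilityTheory TensorProduct

noncomputable section

namespace QM

section Sphere

/-- Push a measure on `H` forward under `ψ ↦ ψ / ‖ψ‖` and view the result as a measure on the unit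
sphere `𝕊(H)`. The vector `0` (which cannot be normalized) contributes nothing. -/
def normalizeToSphere {H : Type*} [NormedAddCommGroup H] [NormedSpace ℂ H] [MeasurableSpace H]
    (μ : Measure H) : Measure (Metric.sphere (0 : H) 1) :=
  (μ.map (fun ψ : H => ((‖ψ‖⁻¹ : ℝ) : ℂ) • ψ)).comap Subtype.val

end Sphere

/-- A density matrix on a finite-dimensional Hilbert space: a positive operator of trace one. -/
structure DensityMatrix (H : Type*) [NormedAddCommGroup H] [InnerProductSpace ℂ H] where
  /-- the underlying operator; `‖ρ.op‖` is the operator norm -/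
  op : H →L[ℂ] H
  isPositive : op.IsPositive
  trace_eq_one : LinearMap.trace ℂ H (op : H →ₗ[ℂ] H) = 1

/-- The law of a complex Gaussian variable with mean `0` and variance `v`: real and imaginary part
are independent real Gaussians with mean `0` and variance `v / 2`
(the point mass at `0` if `v = 0`). -/
def complexGaussian (v : NNReal) : Measure ℂ :=
  ((gaussianReal 0 (v / 2)).prod (gaussianReal 0 (v / 2))).map (fun z : ℝ × ℝ => (⟨z.1, z.2⟩ : ℂ))

namespace DensityMatrix

variable {H : Type*} [NormedAddCommGroup H] [InnerProductSpace ℂ H] [FiniteDimensional ℂ H]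

/-- The eigenvalues `p_n` of `ρ`, with multiplicity. -/
def eigenvalue (ρ : DensityMatrix H) (n : Fin (Module.finrank ℂ H)) : ℝ :=
  ρ.isPositive.isSymmetric.eigenvalues rfl n

/-- An orthonormal basis of eigenvectors `|n⟩` of `ρ`. -/
def eigenbasis (ρ : DensityMatrix H) : OrthonormalBasis (Fin (Module.finrank ℂ H)) ℂ H :=
  ρ.isPositive.isSymmetric.eigenvectorBasis rfl

variable [MeasurableSpace H]

/-- The Gaussian measure `G(ρ)`: the law of `∑ n, Z_n |n⟩` with independent complex Gaussians `Z_n`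
of mean `0` and variance `p_n`. -/
def gaussian (ρ : DensityMatrix H) : Measure H :=
  (Measure.pi fun n => complexGaussian (ρ.eigenvalue n).toNNReal).map
    (fun z => ∑ n, z n • ρ.eigenbasis n)

/-- The adjusted Gaussian measure `GA(ρ)`, with density `‖ψ‖²` relative to `G(ρ)`. -/
def adjustedGaussian (ρ : DensityMatrix H) : Measure H :=
  ρ.gaussian.withDensity (fun ψ => ENNReal.ofReal (‖ψ‖ ^ 2))

/-- `GAP(ρ)`: the law on the unit sphere of `Ψ / ‖Ψ‖`, where `Ψ` has law `GA(ρ)`. -/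
def gap (ρ : DensityMatrix H) : Measure (Metric.sphere (0 : H) 1) :=
  normalizeToSphere ρ.adjustedGaussian

end DensityMatrix

section Bipartite

variable {Ha Hb : Type*} [NormedAddCommGroup Ha] [InnerProductSpace ℂ Ha]
  [NormedAddCommGroup Hb] [InnerProductSpace ℂ Hb]

/-- `Ha ⊗ Hb` carries the Borel σ-algebra of its Hilbert space norm. -/
instance : MeasurableSpace (Ha ⊗[ℂ] Hb) := borel _

instance : BorelSpace (Ha ⊗[ℂ] Hb) := ⟨rfl⟩

/-- The partial inner product `ψ ↦ ⟨y|ψ⟩_b`, i.e. the linear map `Ha ⊗ Hb → Ha` with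
`x ⊗ y' ↦ ⟨y, y'⟩ x`. -/
def partialInner (y : Hb) : Ha ⊗[ℂ] Hb →ₗ[ℂ] Ha :=
  (TensorProduct.rid ℂ Ha).toLinearMap ∘ₗ LinearMap.lTensor Ha (innerₛₗ ℂ y)

@[simp] lemma partialInner_tmul (y y' : Hb) (x : Ha) :
    partialInner y (x ⊗ₜ[ℂ] y') = inner ℂ y y' • x := by
  simp [partialInner]

lemma inner_partialInner (x : Ha) (y : Hb) (ψ : Ha ⊗[ℂ] Hb) :
    inner ℂ x (partialInner y ψ) = inner ℂ (x ⊗ₜ[ℂ] y) ψ := by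
  induction ψ using TensorProduct.induction_on with
  | zero => simp
  | tmul x' y' => simp [mul_comm]
  | add u v hu hv => simp [inner_add_right, hu, hv]

variable [FiniteDimensional ℂ Hb]

/-- The partial trace over `Hb`: `tr_b T = ∑ m, ⟨m|T|m⟩_b` for an orthonormal basis `(|m⟩)` of `Hb`
(the result does not depend on which one). -/
def partialTrace (T : Ha ⊗[ℂ] Hb →ₗ[ℂ] Ha ⊗[ℂ] Hb) : Ha →ₗ[ℂ] Ha :=
  ∑ m, partialInner (stdOrthonormalBasis ℂ Hb m) ∘ₗ T ∘ₗ
    (TensorProduct.mk ℂ Ha Hb).flip (stdOrthonormalBasis ℂ Hb m)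

lemma inner_partialTrace (T : Ha ⊗[ℂ] Hb →ₗ[ℂ] Ha ⊗[ℂ] Hb) (x x' : Ha) :
    inner ℂ x (partialTrace T x') =
      ∑ m, inner ℂ (x ⊗ₜ[ℂ] stdOrthonormalBasis ℂ Hb m)
        (T (x' ⊗ₜ[ℂ] stdOrthonormalBasis ℂ Hb m)) := by
  simp [partialTrace, LinearMap.sum_apply, inner_partialInner]

lemma isSymmetric_partialTrace {T : Ha ⊗[ℂ] Hb →ₗ[ℂ] Ha ⊗[ℂ] Hb} (hT : T.IsSymmetric) :
    (partialTrace T).IsSymmetric := by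
  intro x y
  rw [← inner_conj_symm, inner_partialTrace, inner_partialTrace, map_sum]
  refine Finset.sum_congr rfl fun m _ => ?_
  exact (inner_conj_symm _ _).trans (hT _ _)

lemma trace_partialTrace [FiniteDimensional ℂ Ha] (T : Ha ⊗[ℂ] Hb →ₗ[ℂ] Ha ⊗[ℂ] Hb) :
    LinearMap.trace ℂ Ha (partialTrace T) = LinearMap.trace ℂ (Ha ⊗[ℂ] Hb) T := by
  rw [LinearMap.trace_eq_sum_inner _ (stdOrthonormalBasis ℂ Ha),
    LinearMap.trace_eq_sum_inner _ ((stdOrthonormalBasis ℂ Ha).tensorProduct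
      (stdOrthonormalBasis ℂ Hb)), Fintype.sum_prod_type]
  simp [inner_partialTrace]

/-- The reduced density matrix `tr_b ρ` on `Ha`. -/
def DensityMatrix.reduced [FiniteDimensional ℂ Ha] (ρ : DensityMatrix (Ha ⊗[ℂ] Hb)) : DensityMatrix Ha where
  op := LinearMap.toContinuousLinearMap (partialTrace (ρ.op : Ha ⊗[ℂ] Hb →ₗ[ℂ] Ha ⊗[ℂ] Hb))
  isPositive := by
    refine ⟨isSymmetric_partialTrace ρ.isPositive.isSymmetric, fun x => ?_⟩
    rw [ContinuousLinearMap.reApplyInnerSelf_apply, inner_re_symm]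
    simp only [LinearMap.coe_toContinuousLinearMap', inner_partialTrace, map_sum]
    exact Finset.sum_nonneg fun m _ => ρ.isPositive.re_inner_nonneg_right _
  trace_eq_one := by
    simpa using (trace_partialTrace (ρ.op : Ha ⊗[ℂ] Hb →ₗ[ℂ] Ha ⊗[ℂ] Hb)).trans ρ.trace_eq_one

end Bipartite

section ConditionalWaveFunction

variable {Ha Hb : Type*} [NormedAddCommGroup Ha] [InnerProductSpace ℂ Ha]
  [NormedAddCommGroup Hb] [InnerProductSpace ℂ Hb] [MeasurableSpace Ha] {d : ℕ}

/-- The law of the random index `M`: `ℙ(M = m) = ‖⟨m|ψ⟩_b‖²`. -/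
def indexLaw (ψ : Ha ⊗[ℂ] Hb) (B : OrthonormalBasis (Fin d) ℂ Hb) : Measure (Fin d) :=
  Measure.sum fun m => ENNReal.ofReal (‖partialInner (B m) ψ‖ ^ 2) • Measure.dirac m

/-- The Born distribution `Born_a^{ψ,B}` of the conditional wave function: the law on the unit
sphere of `Ha` of `⟨M|ψ⟩_b / ‖⟨M|ψ⟩_b‖`, where the index `M` has the law `indexLaw ψ B`. -/
def born (ψ : Ha ⊗[ℂ] Hb) (B : OrthonormalBasis (Fin d) ℂ Hb) :
    Measure (Metric.sphere (0 : Ha) 1) :=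
  normalizeToSphere ((indexLaw ψ B).map fun m => partialInner (B m) ψ)

end ConditionalWaveFunction

section UniformONB

variable (E : Type*) [NormedAddCommGroup E] [InnerProductSpace ℂ E]

/-- The set of (ordered) orthonormal bases of `E`, topologized as a subset of `E × ⋯ × E`. -/
instance : TopologicalSpace (OrthonormalBasis (Fin (Module.finrank ℂ E)) ℂ E) :=
  TopologicalSpace.induced (fun B n => B n) inferInstance

instance : MeasurableSpace (OrthonormalBasis (Fin (Module.finrank ℂ E)) ℂ E) := borel _

instance : BorelSpace (OrthonormalBasis (Fin (Module.finrank ℂ E)) ℂ E) := ⟨rfl⟩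

variable [CompleteSpace E] [FiniteDimensional ℂ E]

/-- The unitary group of a finite-dimensional Hilbert space is compact. -/
instance : CompactSpace (unitary (E →L[ℂ] E)) := by
  have : ProperSpace (E →L[ℂ] E) := FiniteDimensional.proper ℂ _
  refine isCompact_iff_compactSpace.mp (Metric.isCompact_of_isClosed_isBounded isClosed_unitary
    (Metric.isBounded_closedBall (x := 0) (r := 1) |>.subset fun U hU => ?_))
  rw [mem_closedBall_zero_iff]
  refine ContinuousLinearMap.opNorm_le_bound _ zero_le_one fun x => ?_
  rw [one_mul]
  exact ((Unitary.linearIsometryEquiv ⟨U, hU⟩).norm_map x).le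

/-- The uniform distribution `u_ONB` over the orthonormal bases of `E`: the law of the image of a
fixed orthonormal basis under a Haar distributed random unitary operator. -/
def uONB : Measure (OrthonormalBasis (Fin (Module.finrank ℂ E)) ℂ E) :=
  (Measure.haarMeasure (⊤ : TopologicalSpace.PositiveCompacts (unitary (E →L[ℂ] E)))).map
    (fun U => (stdOrthonormalBasis ℂ E).map (Unitary.linearIsometryEquiv U))

end UniformONB

end QM

end

noncomputable section

namespace QM

/-! ### Moments and characteristic function of one complex Gaussian -/

section ComplexGaussian

/-! Extend `f` to the function g(ψ) = ‖ψ‖² f(ψ/‖ψ‖) of degree 2. The Born weights supply the factor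
‖ψ‖², so for a unit vector ψ the Born mean of `f` is ∑ₘ g(⟨m|ψ⟩). In the same way the mean c of `f`
under GAP(σ), σ = tr_b ρ, is the Gaussian mean of g under G(σ). It remains to show that X = ∑ₘ
G(⟨m|Ψ⟩) is small for Ψ with law G(ρ), where G = g − c‖·‖² has mean zero under G(σ).

Expand E X² over pairs (m, m'). Each term depends only on the joint covariance of ⟨m|Ψ⟩ and ⟨m'|Ψ⟩,
which consists of four blocks of ρ. If that covariance were diag(σ/d, σ/d), the term would factor
into two zero means. Compactness and homogeneity bound the error by η(2/d)² + C·D, with D the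
squared Hilbert–Schmidt distance of the covariances (`exists_abs_integral_sub_le`). That D enters
squared is what makes the sum over all d² pairs manageable: off-diagonal blocks add up to at most tr
ρ² ≤ ‖ρ‖, and a diagonal block is a matrix of quadratic forms at a uniformly distributed unit
vector, with variance controlled by Hilbert–Schmidt norms over d². On average over the basis the D
sum to at most 6‖ρ‖ (`integral_sum_deviation_le`), while C does not see ρ or `Hb`.

The return from G(ρ) to GAP(ρ) needs no concentration of ‖Ψ‖: on the bad event ε‖Ψ‖² ≤ |X|, so the
weight ‖Ψ‖² is at most δ/2 + X²/(2δε²) (`gap_setOf_le`). -/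

lemma measurable_complex_mk : Measurable (fun z : ℝ × ℝ => (⟨z.1, z.2⟩ : ℂ)) :=
  Complex.measurableEquivRealProd.symm.measurable

instance (v : NNReal) : IsProbabilityMeasure (complexGaussian v) :=
  Measure.isProbabilityMeasure_map measurable_complex_mk.aemeasurable

lemma integral_complexGaussian_exp (v : NNReal) (a : ℂ) :
    ∫ z, Complex.exp ((star a * z).re * Complex.I) ∂complexGaussian v
      = Complex.exp (-(v * ‖a‖ ^ 2 / 4 : ℝ)) := by
  rw [complexGaussian, integral_map measurable_complex_mk.aemeasurable
    (by fun_prop)]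
  have h1 := charFun_gaussianReal (μ := 0) (v := v / 2) a.re
  have h2 := charFun_gaussianReal (μ := 0) (v := v / 2) a.im
  rw [charFun_apply_real] at h1 h2
  have h : ∀ z : ℝ × ℝ, Complex.exp ((star a * (⟨z.1, z.2⟩ : ℂ)).re * Complex.I)
      = Complex.exp (a.re * z.1 * Complex.I) * Complex.exp (a.im * z.2 * Complex.I) := by
    intro z
    rw [← Complex.exp_add]
    congr 1
    simp
    ring
  simp_rw [h]
  rw [integral_prod_mul (f := fun x : ℝ => Complex.exp (a.re * x * Complex.I))
    (g := fun x : ℝ => Complex.exp (a.im * x * Complex.I)), h1, h2, ← Complex.exp_add]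
  congr 1
  rw [Complex.sq_norm, Complex.normSq_apply]
  push_cast
  ring

lemma complexGaussian_eq_map (v : NNReal) :
    complexGaussian v = (complexGaussian 1).map (fun z => (Real.sqrt v : ℂ) * z) := by
  have hg : gaussianReal 0 (v / 2) = (gaussianReal 0 (1 / 2)).map (Real.sqrt v * ·) := by
    rw [gaussianReal_map_const_mul]
    congr 1
    · simp
    · ext
      simp [Real.sq_sqrt]
      ring
  rw [complexGaussian, complexGaussian, hg, Measure.map_map (by fun_prop) measurable_complex_mk,
    Measure.map_prod_map _ _ (by fun_prop) (by fun_prop),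
    Measure.map_map measurable_complex_mk (by fun_prop)]
  congr 1
  ext z
  apply Complex.ext <;> simp

lemma integrable_norm_pow_complexGaussian (v : NNReal) (n : ℕ) :
    Integrable (fun z : ℂ => ‖z‖ ^ n) (complexGaussian v) := by
  rcases Nat.eq_zero_or_pos n with rfl | hn
  · simp
  have hn' : n ≠ 0 := hn.ne'
  have hm : MemLp (id : ℂ → ℂ) n (complexGaussian v) := by
    rw [complexGaussian, memLp_map_measure_iff (by fun_prop) measurable_complex_mk.aemeasurable]
    have h1 : MemLp (fun z : ℝ × ℝ => z.1) n
        ((gaussianReal 0 (v / 2)).prod (gaussianReal 0 (v / 2))) :=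
      (memLp_id_gaussianReal' n (by simp)).comp_fst _
    have h2 : MemLp (fun z : ℝ × ℝ => z.2) n
        ((gaussianReal 0 (v / 2)).prod (gaussianReal 0 (v / 2))) :=
      (memLp_id_gaussianReal' n (by simp)).comp_snd _
    refine (h1.norm.add h2.norm).mono (measurable_complex_mk.aestronglyMeasurable) ?_
    refine ae_of_all _ fun z => ?_
    simp only [Function.comp, id, Pi.add_apply, Real.norm_eq_abs]
    rw [abs_of_nonneg (by positivity)]
    exact Complex.norm_le_abs_re_add_abs_im _
  simpa using hm.integrable_norm_pow hn'

lemma integral_norm_sq_complexGaussian (v : NNReal) :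
    ∫ z, ‖z‖ ^ 2 ∂complexGaussian v = v := by
  rw [complexGaussian, integral_map measurable_complex_mk.aemeasurable (by fun_prop)]
  have hv : ∫ x, x ^ 2 ∂gaussianReal 0 (v / 2) = (v / 2 : NNReal) := by
    rw [← variance_fun_id_gaussianReal (μ := 0) (v := v / 2), variance_of_integral_eq_zero]
    · fun_prop
    · simp
  have hi : Integrable (fun x : ℝ => x ^ 2) (gaussianReal 0 (v / 2)) := by
    have := (memLp_id_gaussianReal' (μ := 0) (v := v / 2) 2 (by simp)).integrable_sq
    simpa using this
  have h : ∀ z : ℝ × ℝ, ‖(⟨z.1, z.2⟩ : ℂ)‖ ^ 2 = z.1 ^ 2 + z.2 ^ 2 := by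
    intro z
    rw [Complex.sq_norm, Complex.normSq_apply]
    ring
  simp_rw [h]
  rw [integral_add (hi.comp_fst _) (hi.comp_snd _)]
  rw [integral_fun_fst (fun x : ℝ => x ^ 2), integral_fun_snd (fun x : ℝ => x ^ 2), hv]
  simp

end ComplexGaussian

/-! ### Linear images of standard Gaussian families -/

section StandardGaussian

variable {κ κ' k : Type*} [Fintype κ] [Fintype κ'] [Fintype k]

/-- The law of a family of independent complex Gaussians of mean `0` and variance `1`. -/
def standardGaussian (κ : Type*) [Fintype κ] : Measure (κ → ℂ) :=
  Measure.pi fun _ => complexGaussian 1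

instance : IsProbabilityMeasure (standardGaussian κ) := by
  unfold standardGaussian; infer_instance

lemma integrable_norm_pow_four_standardGaussian :
    Integrable (fun z : κ → ℂ => ‖z‖ ^ 4) (standardGaussian κ) := by
  have h : Integrable (fun z : κ → ℂ => ∑ n, ‖z n‖ ^ 4) (standardGaussian κ) :=
    integrable_finsetSum _ fun n _ =>
      integrable_comp_eval (μ := fun _ : κ => complexGaussian 1) (f := fun x : ℂ => ‖x‖ ^ 4)
        (integrable_norm_pow_complexGaussian 1 4)
  refine h.mono' (by fun_prop) (ae_of_all _ fun z => ?_)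
  rw [norm_pow, norm_norm]
  rcases isEmpty_or_nonempty κ with hκ | hκ
  · simp [Subsingleton.elim z 0]
  · obtain ⟨n, -, hn⟩ := Finset.exists_mem_eq_sup (Finset.univ : Finset κ) Finset.univ_nonempty
      (fun n => ‖z n‖₊)
    have hz : ‖z‖ = ‖z n‖ := by rw [Pi.norm_def, hn]; simp
    rw [hz]
    exact Finset.single_le_sum (f := fun n => ‖z n‖ ^ 4) (fun _ _ => by positivity)
      (Finset.mem_univ n)

lemma charFun_linear (T : Matrix k κ ℂ) (ξ : EuclideanSpace ℂ k) :
    charFun ((standardGaussian κ).map (fun z => WithLp.toLp 2 (T.mulVec z))) ξ =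
      Complex.exp (-((star ξ.ofLp ⬝ᵥ (T * T.conjTranspose).mulVec ξ.ofLp).re / 4 : ℝ)) := by
  classical
  rw [charFun_apply, integral_map (by fun_prop) (by fun_prop)]
  set a : κ → ℂ := T.conjTranspose.mulVec ξ.ofLp with ha
  have hin : ∀ z : κ → ℂ, Complex.exp ((inner ℝ (WithLp.toLp 2 (T.mulVec z)) ξ : ℝ) * Complex.I)
      = ∏ n, Complex.exp ((star (a n) * z n).re * Complex.I) := by
    intro z
    rw [← Complex.exp_sum, ← Finset.sum_mul, ← Complex.ofReal_sum, ← Complex.re_sum]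
    congr 3
    have hre : inner ℝ (WithLp.toLp 2 (T.mulVec z)) ξ = (T.mulVec z ⬝ᵥ star ξ.ofLp).re := by
      rw [real_inner_comm, PiLp.inner_apply, dotProduct, Complex.re_sum]
      refine Finset.sum_congr rfl fun i _ => ?_
      rw [Complex.inner]
      rfl
    rw [hre]
    congr 1
    change T.mulVec z ⬝ᵥ star ξ.ofLp = star a ⬝ᵥ z
    rw [dotProduct_comm, Matrix.dotProduct_mulVec, ha, Matrix.star_mulVec,
      Matrix.conjTranspose_conjTranspose]
  simp_rw [hin]
  rw [standardGaussian, integral_fintype_prod_eq_prod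
    (f := fun n z => Complex.exp ((star (a n) * z).re * Complex.I))]
  simp_rw [integral_complexGaussian_exp]
  rw [← Complex.exp_sum, Finset.sum_neg_distrib, ← Complex.ofReal_sum]
  congr 3
  rw [Matrix.dotProduct_mulVec, ← Matrix.vecMul_vecMul, ← Matrix.dotProduct_mulVec, ← ha]
  have : Matrix.vecMul (star ξ.ofLp) T = star a := by
    rw [ha, Matrix.star_mulVec, Matrix.conjTranspose_conjTranspose]
  rw [this, dotProduct, Complex.re_sum, Finset.sum_div]
  refine Finset.sum_congr rfl fun n _ => ?_
  simp only [NNReal.coe_one, one_mul, Pi.star_apply]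
  congr 1
  rw [Complex.sq_norm, Complex.normSq_apply]
  simp

/-- The characteristic function of a linear image sees `T` only through `T * T.conjTranspose`. The
numbers of driving variables may differ, so a vector driven by dim H Gaussians can be compared with
one driven by a square matrix of fixed size. -/
lemma map_mulVec_standardGaussian_eq {T : Matrix k κ ℂ} {T' : Matrix k κ' ℂ}
    (h : T * T.conjTranspose = T' * T'.conjTranspose) :
    (standardGaussian κ).map T.mulVec = (standardGaussian κ').map T'.mulVec := by
  have hm : Measurable T.mulVec := by
    exact (Continuous.matrix_mulVec continuous_const continuous_id).measurable
  have hm' : Measurable T'.mulVec := by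
    exact (Continuous.matrix_mulVec continuous_const continuous_id).measurable
  -- Characteristic functions need an inner product, hence the detour through `EuclideanSpace`.
  have h1 : (standardGaussian κ).map (fun z => WithLp.toLp 2 (T.mulVec z))
      = (standardGaussian κ').map (fun z => WithLp.toLp 2 (T'.mulVec z)) := by
    have : IsProbabilityMeasure ((standardGaussian κ).map (fun z => WithLp.toLp 2 (T.mulVec z))) :=
      Measure.isProbabilityMeasure_map (by fun_prop)
    have : IsProbabilityMeasure ((standardGaussian κ').map (fun z => WithLp.toLp 2 (T'.mulVec z))) :=
      Measure.isProbabilityMeasure_map (by fun_prop)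
    refine Measure.ext_of_charFun (funext fun ξ => ?_)
    rw [charFun_linear, charFun_linear, h]
  have h2 := congrArg (fun μ => μ.map (WithLp.ofLp (p := 2) (V := k → ℂ))) h1
  rwa [Measure.map_map (by fun_prop) (by fun_prop), Measure.map_map (by fun_prop) (by fun_prop)] at h2

end StandardGaussian

/-! ### Compactness and homogeneity estimates -/

section Compactness

variable {X : Type*} [TopologicalSpace X] {P : Set X}

/-- On a compact set, a function that is nonpositive wherever `v` vanishes is dominated by `v` up to
an arbitrarily small error. -/
lemma exists_forall_le_add_mul [T2Space X] (hP : IsCompact P) {u v : X → ℝ}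
    (hu : ContinuousOn u P) (hv : ContinuousOn v P) (hv0 : ∀ x ∈ P, 0 ≤ v x)
    (huv : ∀ x ∈ P, v x = 0 → u x ≤ 0) {η : ℝ} (hη : 0 < η) :
    ∃ C, 0 ≤ C ∧ ∀ x ∈ P, u x ≤ η + C * v x := by
  -- Where `u < η` nothing is needed. On the compact remainder `v` has a positive minimum, and C is
  -- the maximum of `u` divided by it.
  have hK : IsCompact (P ∩ u ⁻¹' Set.Ici η) :=
    hP.of_isClosed_subset (hu.preimage_isClosed_of_isClosed hP.isClosed isClosed_Ici)
      Set.inter_subset_left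
  rcases (P ∩ u ⁻¹' Set.Ici η).eq_empty_or_nonempty with he | hne
  · refine ⟨0, le_rfl, fun x hx => ?_⟩
    by_contra! hc
    have : x ∈ P ∩ u ⁻¹' Set.Ici η := ⟨hx, by simp only [Set.mem_preimage, Set.mem_Ici]; linarith⟩
    rw [he] at this
    exact this
  · obtain ⟨x₀, hx₀, hmin⟩ := hK.exists_isMinOn hne (hv.mono Set.inter_subset_left)
    obtain ⟨x₁, hx₁, hmax⟩ := hK.exists_isMaxOn hne (hu.mono Set.inter_subset_left)
    have hvpos : 0 < v x₀ := by
      refine lt_of_le_of_ne (hv0 _ hx₀.1) fun h => ?_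
      have h1 := huv x₀ hx₀.1 h.symm
      have h2 : η ≤ u x₀ := hx₀.2
      linarith
    have hu1 : η ≤ u x₁ := hx₁.2
    have hC : 0 ≤ u x₁ / v x₀ := div_nonneg (by linarith) hvpos.le
    refine ⟨u x₁ / v x₀, hC, fun x hx => ?_⟩
    by_cases hxu : η ≤ u x
    · have h1 : u x ≤ u x₁ := hmax ⟨hx, hxu⟩
      have h2 : v x₀ ≤ v x := hmin ⟨hx, hxu⟩
      have h3 : u x₁ ≤ u x₁ / v x₀ * v x := by
        rw [div_mul_eq_mul_div, le_div_iff₀ hvpos]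
        exact mul_le_mul_of_nonneg_left h2 (by linarith)
      linarith
    · have : 0 ≤ u x₁ / v x₀ * v x := mul_nonneg hC (hv0 x hx)
      linarith

/-- Degree 4 reduces the bound to the closed unit ball, where compactness applies; it provides an
integrable majorant uniform in the parameter. -/
lemma exists_forall_abs_le_norm_pow_four {V : Type*} [NormedAddCommGroup V] [NormedSpace ℝ V]
    [ProperSpace V] {H : X → V → ℝ} (hH : Continuous fun p : X × V => H p.1 p.2)
    (hh : ∀ x (t : ℝ) v, 0 ≤ t → H x (t • v) = t ^ 4 * H x v) (hP : IsCompact P) :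
    ∃ C, 0 ≤ C ∧ ∀ x ∈ P, ∀ v, |H x v| ≤ C * ‖v‖ ^ 4 := by
  obtain ⟨C, hC⟩ := (hP.prod (isCompact_closedBall (0 : V) 1)).exists_bound_of_continuousOn
    hH.continuousOn
  refine ⟨|C|, abs_nonneg C, fun x hx v => ?_⟩
  rcases eq_or_ne v 0 with rfl | hv
  · have := hh x 0 0 le_rfl
    rw [smul_zero, zero_pow (by norm_num), zero_mul] at this
    rw [this, abs_zero]
    positivity
  · have hv' : ‖v‖ ≠ 0 := norm_ne_zero_iff.mpr hv
    have h1 : H x v = ‖v‖ ^ 4 * H x (‖v‖⁻¹ • v) := by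
      rw [← hh x _ _ (norm_nonneg v), smul_smul, mul_inv_cancel₀ hv', one_smul]
    have h2 := hC (x, ‖v‖⁻¹ • v) ⟨hx, by simp [norm_smul, hv']⟩
    rw [h1, abs_mul, abs_of_nonneg (by positivity : 0 ≤ ‖v‖ ^ 4), mul_comm]
    exact mul_le_mul_of_nonneg_right (h2.trans (le_abs_self C)) (by positivity)

end Compactness

/-! ### Gaussian means depending on a parameter -/

section GaussianMean

variable {X : Type*} [TopologicalSpace X] {P : Set X} {κ : Type*} [Fintype κ]

lemma continuousOn_integral_standardGaussian [FirstCountableTopology X]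
    {H : X → (κ → ℂ) → ℝ} (hH : Continuous fun p : X × (κ → ℂ) => H p.1 p.2)
    (hh : ∀ x (t : ℝ) v, 0 ≤ t → H x (t • v) = t ^ 4 * H x v) (hP : IsCompact P) :
    ContinuousOn (fun x => ∫ z, H x z ∂standardGaussian κ) P := by
  obtain ⟨C, -, hC⟩ := exists_forall_abs_le_norm_pow_four hH hh hP
  refine continuousOn_of_dominated (bound := fun z => C * ‖z‖ ^ 4) ?_ ?_ ?_ ?_
  · exact fun x _ => (hH.comp (by fun_prop : Continuous fun z => (x, z))).aestronglyMeasurable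
  · exact fun x hx => ae_of_all _ fun z => hC x hx z
  · exact integrable_norm_pow_four_standardGaussian.const_mul C
  · exact ae_of_all _ fun z => (hH.comp (by fun_prop : Continuous fun x => (x, z))).continuousOn

lemma integrable_standardGaussian {h : (κ → ℂ) → ℝ} (hc : Continuous h)
    (hh : ∀ (t : ℝ) v, 0 ≤ t → h (t • v) = t ^ 4 * h v) : Integrable h (standardGaussian κ) := by
  obtain ⟨C, -, hC⟩ := exists_forall_abs_le_norm_pow_four (X := Unit) (H := fun _ => h)
    (by fun_prop) (fun _ => hh) isCompact_univ
  exact (integrable_norm_pow_four_standardGaussian.const_mul C).mono' hc.aestronglyMeasurable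
    (ae_of_all _ fun z => hC () trivial z)

end GaussianMean

/-! ### Squared Hilbert–Schmidt norm of matrices -/

section Frobenius

variable {k κ m n : Type*} [Fintype k] [Fintype κ] [Fintype m] [Fintype n]

/-- The squared Hilbert--Schmidt norm of a matrix. -/
def frobSq (A : Matrix m n ℂ) : ℝ := ∑ i, ∑ j, ‖A i j‖ ^ 2

lemma frobSq_nonneg (A : Matrix m n ℂ) : 0 ≤ frobSq A :=
  Finset.sum_nonneg fun _ _ => Finset.sum_nonneg fun _ _ => by positivity

lemma frobSq_smul (c : ℂ) (A : Matrix m n ℂ) : frobSq (c • A) = ‖c‖ ^ 2 * frobSq A := by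
  simp [frobSq, Finset.mul_sum, mul_pow]

lemma norm_apply_sq_le_frobSq (A : Matrix m n ℂ) (i : m) (j : n) : ‖A i j‖ ^ 2 ≤ frobSq A :=
  (Finset.single_le_sum (f := fun j => ‖A i j‖ ^ 2) (fun _ _ => by positivity)
    (Finset.mem_univ j)).trans
  (Finset.single_le_sum (f := fun i => ∑ j, ‖A i j‖ ^ 2)
    (fun _ _ => Finset.sum_nonneg fun _ _ => by positivity) (Finset.mem_univ i))

lemma frobSq_eq_zero {A : Matrix m n ℂ} : frobSq A = 0 ↔ A = 0 := by
  refine ⟨fun h => ?_, fun h => by simp [h, frobSq]⟩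
  ext i j
  have := norm_apply_sq_le_frobSq A i j
  rw [h] at this
  simpa using le_antisymm this (by positivity)

lemma mul_conjTranspose_apply_self {m : Type*} (A : Matrix m n ℂ) (i : m) :
    (A * A.conjTranspose) i i = ((∑ j, ‖A i j‖ ^ 2 : ℝ) : ℂ) := by
  simp [Matrix.mul_apply, Matrix.conjTranspose_apply, Complex.mul_conj, Complex.normSq_eq_norm_sq]

lemma frobSq_eq_trace (A : Matrix m n ℂ) : (frobSq A : ℂ) = (A * A.conjTranspose).trace := by
  simp only [Matrix.trace, Matrix.diag, mul_conjTranspose_apply_self, frobSq]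
  push_cast
  rfl

lemma norm_trace_sq_le (A : Matrix m m ℂ) : ‖A.trace‖ ^ 2 ≤ Fintype.card m * frobSq A := by
  calc ‖A.trace‖ ^ 2 ≤ (∑ i, ‖A i i‖) ^ 2 := by
        gcongr
        exact norm_sum_le _ _
    _ ≤ Fintype.card m * ∑ i, ‖A i i‖ ^ 2 := by
        simpa using sq_sum_le_card_mul_sum_sq (s := Finset.univ) (f := fun i => ‖A i i‖)
    _ ≤ Fintype.card m * frobSq A := by
        gcongr
        exact Finset.sum_le_sum fun i _ => Finset.single_le_sum (f := fun j => ‖A i j‖ ^ 2)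
          (fun _ _ => by positivity) (Finset.mem_univ i)

/-- The squared Hilbert--Schmidt norms of `S` and `S₀` differ by at most a multiple of the distance
of the covariances. -/
lemma sq_frobSq_sub_le (S : Matrix m n ℂ) (S₀ : Matrix m κ ℂ) :
    (frobSq S - frobSq S₀) ^ 2 ≤
      Fintype.card m * frobSq (S * S.conjTranspose - S₀ * S₀.conjTranspose) := by
  refine le_trans (le_of_eq ?_) (norm_trace_sq_le _)
  rw [Matrix.trace_sub, ← frobSq_eq_trace, ← frobSq_eq_trace, ← Complex.ofReal_sub,
    Complex.norm_real, Real.norm_eq_abs, sq_abs]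

end Frobenius

/-! ### Continuity of Gaussian means in the covariance -/

section GaussianContinuity

variable {k κ : Type*} [Fintype κ]

lemma integral_mulVec_eq [Fintype k] {κ' : Type*} [Fintype κ'] {T : Matrix k κ ℂ} {T' : Matrix k κ' ℂ}
    (h : T * T.conjTranspose = T' * T'.conjTranspose) {q : (k → ℂ) → ℝ} (hq : Continuous q) :
    ∫ z, q (T.mulVec z) ∂standardGaussian κ = ∫ z, q (T'.mulVec z) ∂standardGaussian κ' := by
  have hm : Measurable T.mulVec :=
    (Continuous.matrix_mulVec continuous_const continuous_id).measurable
  have hm' : Measurable T'.mulVec :=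
    (Continuous.matrix_mulVec continuous_const continuous_id).measurable
  rw [← integral_map hm.aemeasurable hq.aestronglyMeasurable,
    ← integral_map hm'.aemeasurable hq.aestronglyMeasurable, map_mulVec_standardGaussian_eq h]

variable {h : ℝ → (k → ℂ) → ℝ}

lemma integral_smul_mulVec (hh : ∀ c (t : ℝ) v, 0 ≤ t → h c (t • v) = t ^ 4 * h c v) (c : ℝ) {t : ℝ}
    (ht : 0 ≤ t) (S : Matrix k κ ℂ) :
    ∫ z, h c (((t : ℂ) • S).mulVec z) ∂standardGaussian κ
      = t ^ 4 * ∫ z, h c (S.mulVec z) ∂standardGaussian κ := by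
  rw [← integral_const_mul]
  refine integral_congr_ae (ae_of_all _ fun z => ?_)
  simp only
  rw [← hh c t _ ht, Matrix.smul_mulVec]
  rfl

variable [Fintype k]

/-- The normalization makes the parameter set compact, and the difference of means vanishes wherever
the covariances agree, so `exists_forall_le_add_mul` applies. The real parameter `c` is included
because the later mean `c` varies with ρ and only a bound on it is available. -/
lemma exists_abs_integral_sub_le_normalized
    (hc : Continuous fun p : ℝ × (k → ℂ) => h p.1 p.2)
    (hh : ∀ c (t : ℝ) v, 0 ≤ t → h c (t • v) = t ^ 4 * h c v) (M : ℝ) {η : ℝ} (hη : 0 < η) :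
    ∃ C, 0 ≤ C ∧ ∀ c, |c| ≤ M → ∀ S S₀ : Matrix k k ℂ, frobSq S + frobSq S₀ = 1 →
      |∫ z, h c (S.mulVec z) ∂standardGaussian k - ∫ z, h c (S₀.mulVec z) ∂standardGaussian k|
        ≤ η + C * frobSq (S * S.conjTranspose - S₀ * S₀.conjTranspose) := by
  let P : Set (ℝ × (k → k → ℂ) × (k → k → ℂ)) :=
    {x | |x.1| ≤ M ∧ frobSq (Matrix.of x.2.1) + frobSq (Matrix.of x.2.2) = 1}
  have hf1 : Continuous fun S : k → k → ℂ => frobSq (Matrix.of S) := by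
    simp only [frobSq, Matrix.of_apply]; fun_prop
  have hPclosed : IsClosed P :=
    (isClosed_le continuous_fst.abs continuous_const).inter
      (isClosed_eq ((hf1.comp continuous_snd.fst).add (hf1.comp continuous_snd.snd))
        continuous_const)
  have hnorm : ∀ S : k → k → ℂ, frobSq (Matrix.of S) ≤ 1 → S ∈ Metric.closedBall (0 : k → k → ℂ) 1 := by
    intro S hS
    rw [mem_closedBall_zero_iff, pi_norm_le_iff_of_nonneg zero_le_one]
    intro i
    rw [pi_norm_le_iff_of_nonneg zero_le_one]
    intro j
    have := (norm_apply_sq_le_frobSq (Matrix.of S) i j).trans hS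
    rw [Matrix.of_apply] at this
    exact (sq_le_one_iff₀ (norm_nonneg _)).mp this
  have hP : IsCompact P := by
    refine IsCompact.of_isClosed_subset ((isCompact_Icc (a := -M) (b := M)).prod
      ((isCompact_closedBall (0 : k → k → ℂ) 1).prod (isCompact_closedBall (0 : k → k → ℂ) 1)))
      hPclosed ?_
    rintro ⟨c, S, S₀⟩ ⟨h1, h2⟩
    have h3 := frobSq_nonneg (Matrix.of S)
    have h4 := frobSq_nonneg (Matrix.of S₀)
    simp only at h1 h2
    exact ⟨abs_le.mp h1, hnorm _ (by linarith), hnorm _ (by linarith)⟩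
  have hcont : ∀ p : ℝ × (k → k → ℂ) × (k → k → ℂ) → (k → k → ℂ), Continuous p →
      ContinuousOn (fun x => ∫ z, h x.1 ((Matrix.of (p x)).mulVec z) ∂standardGaussian k) P := by
    intro p hp
    refine continuousOn_integral_standardGaussian
      (H := fun x z => h x.1 ((Matrix.of (p x)).mulVec z)) ?_ ?_ hP
    · refine hc.comp (Continuous.prodMk (by fun_prop) ?_)
      exact Continuous.matrix_mulVec (hp.comp continuous_fst) continuous_snd
    · intro x t v ht
      rw [Matrix.mulVec_smul, hh _ _ _ ht]
  obtain ⟨C, hC0, hC⟩ := exists_forall_le_add_mul hP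
    (u := fun x => |∫ z, h x.1 ((Matrix.of x.2.1).mulVec z) ∂standardGaussian k
      - ∫ z, h x.1 ((Matrix.of x.2.2).mulVec z) ∂standardGaussian k|)
    (v := fun x => frobSq (Matrix.of x.2.1 * (Matrix.of x.2.1).conjTranspose
      - Matrix.of x.2.2 * (Matrix.of x.2.2).conjTranspose))
    ((hcont (fun x => x.2.1) (by fun_prop)).sub (hcont (fun x => x.2.2) (by fun_prop))).abs
    (by
      simp only [frobSq, Matrix.sub_apply, Matrix.mul_apply, Matrix.conjTranspose_apply,
        Matrix.of_apply]
      fun_prop)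
    (fun x _ => frobSq_nonneg _)
    (fun x _ hx => by
      rw [frobSq_eq_zero, sub_eq_zero] at hx
      rw [integral_mulVec_eq hx (q := h x.1) (hc.comp (by fun_prop : Continuous fun z => (x.1, z)))]
      simp) hη
  exact ⟨C, hC0, fun c hcM S S₀ hS => hC (c, S, S₀) ⟨hcM, hS⟩⟩

/-- The mean of a function of degree `4` of a Gaussian vector depends continuously on the covariance
of the vector, with an estimate that is quadratic in the distance of the covariances. -/
lemma exists_abs_integral_sub_le
    (hc : Continuous fun p : ℝ × (k → ℂ) => h p.1 p.2)
    (hh : ∀ c (t : ℝ) v, 0 ≤ t → h c (t • v) = t ^ 4 * h c v) (M : ℝ) {η : ℝ} (hη : 0 < η) :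
    ∃ C, 0 ≤ C ∧ ∀ c, |c| ≤ M → ∀ S S₀ : Matrix k k ℂ,
      |∫ z, h c (S.mulVec z) ∂standardGaussian k - ∫ z, h c (S₀.mulVec z) ∂standardGaussian k|
        ≤ η * frobSq S₀ ^ 2 + C * frobSq (S * S.conjTranspose - S₀ * S₀.conjTranspose) := by
  obtain ⟨C, hC0, hC⟩ := exists_abs_integral_sub_le_normalized hc hh M
    (by positivity : 0 < η / 8)
  -- The additional term pays for replacing `frobSq S` by `frobSq S₀`, whose difference is the trace
  -- of the difference of the covariances.
  refine ⟨C + η * Fintype.card k, by positivity, fun c hcM S S₀ => ?_⟩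
  set D := frobSq (S * S.conjTranspose - S₀ * S₀.conjTranspose) with hD
  have hD0 : 0 ≤ D := frobSq_nonneg _
  have hS := frobSq_nonneg S
  have hS₀ := frobSq_nonneg S₀
  have key : |∫ z, h c (S.mulVec z) ∂standardGaussian k
      - ∫ z, h c (S₀.mulVec z) ∂standardGaussian k|
      ≤ η / 8 * (frobSq S + frobSq S₀) ^ 2 + C * D := by
    rcases (add_nonneg hS hS₀).eq_or_lt with h0 | hpos
    · have h1 : S = 0 := frobSq_eq_zero.mp (by linarith)
      have h2 : S₀ = 0 := frobSq_eq_zero.mp (by linarith)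
      rw [h1, h2, sub_self, abs_zero]
      positivity
    -- Dividing both matrices by `r` normalizes them; the means and the squared distance of the
    -- covariances both scale with the fourth power.
    · set r := Real.sqrt (frobSq S + frobSq S₀) with hr
      have hr0 : 0 < r := Real.sqrt_pos.mpr hpos
      have hr2 : r ^ 2 = frobSq S + frobSq S₀ := Real.sq_sqrt hpos.le
      have hnr : ‖((r⁻¹ : ℝ) : ℂ)‖ ^ 2 = (r ^ 2)⁻¹ := by
        rw [Complex.norm_real, Real.norm_eq_abs, sq_abs, inv_pow]
      have h1 := hC c hcM (((r⁻¹ : ℝ) : ℂ) • S) (((r⁻¹ : ℝ) : ℂ) • S₀) (by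
        rw [frobSq_smul, frobSq_smul, hnr, ← mul_add, hr2, inv_mul_cancel₀ hpos.ne'])
      rw [integral_smul_mulVec hh c (by positivity), integral_smul_mulVec hh c (by positivity),
        ← mul_sub, abs_mul, abs_of_nonneg (by positivity : 0 ≤ r⁻¹ ^ 4)] at h1
      have h2 : frobSq ((((r⁻¹ : ℝ) : ℂ) • S) * (((r⁻¹ : ℝ) : ℂ) • S).conjTranspose
          - (((r⁻¹ : ℝ) : ℂ) • S₀) * (((r⁻¹ : ℝ) : ℂ) • S₀).conjTranspose) = r⁻¹ ^ 4 * D := by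
        have : ∀ A : Matrix k k ℂ, (((r⁻¹ : ℝ) : ℂ) • A) * (((r⁻¹ : ℝ) : ℂ) • A).conjTranspose
            = ((r⁻¹ ^ 2 : ℝ) : ℂ) • (A * A.conjTranspose) := by
          intro A
          rw [Matrix.conjTranspose_smul, Matrix.smul_mul, Matrix.mul_smul, smul_smul]
          congr 1
          rw [Complex.star_def, Complex.conj_ofReal]
          push_cast
          ring
        rw [this, this, ← smul_sub, frobSq_smul, Complex.norm_real, Real.norm_eq_abs, sq_abs, hD]
        ring
      rw [h2] at h1
      have h3 := mul_le_mul_of_nonneg_left h1 (by positivity : 0 ≤ r ^ 4)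
      have h4 : r ^ 4 * r⁻¹ ^ 4 = 1 := by rw [← mul_pow, mul_inv_cancel₀ hr0.ne', one_pow]
      rw [← mul_assoc, h4, one_mul] at h3
      refine h3.trans (le_of_eq ?_)
      rw [← hr2]
      linear_combination C * D * h4
  refine key.trans ?_
  have h5 := sq_frobSq_sub_le S S₀
  rw [← hD] at h5
  -- Write the sum as the difference plus `2 * frobSq S₀`; the factor 8 is absorbed by the choice `η
  -- / 8`.
  have h6 : (frobSq S + frobSq S₀) ^ 2 ≤ 8 * frobSq S₀ ^ 2 + 2 * (frobSq S - frobSq S₀) ^ 2 := by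
    nlinarith [sq_nonneg (frobSq S - frobSq S₀ - 2 * frobSq S₀)]
  have h7 := mul_le_mul_of_nonneg_left (h6.trans (by gcongr)) (by positivity : 0 ≤ η / 8)
  have h8 : 0 ≤ η * (Fintype.card k * D) := by positivity
  calc _ ≤ _ := add_le_add_left h7 _
    _ ≤ _ := by nlinarith

end GaussianContinuity

/-! ### Fourth moments of isotropic unit vectors -/

section Isotropic

variable {E : Type*} [NormedAddCommGroup E] [InnerProductSpace ℂ E] [FiniteDimensional ℂ E]

/-- The isometry between the two lines extends to the whole space, by finite dimension. -/
lemma exists_linearIsometryEquiv_apply_eq {v w : E} (hv : ‖v‖ = 1) (hw : ‖w‖ = 1) :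
    ∃ V : E ≃ₗᵢ[ℂ] E, V v = w := by
  let L : (Submodule.span ℂ {v}) →ₗᵢ[ℂ] E :=
    (Submodule.span ℂ {w}).subtypeₗᵢ.comp
      ((LinearIsometryEquiv.toSpanUnitSingleton v hv).symm.trans
        (LinearIsometryEquiv.toSpanUnitSingleton w hw)).toLinearIsometry
  refine ⟨L.extend.toLinearIsometryEquiv rfl, ?_⟩
  have h1 : LinearIsometryEquiv.toSpanUnitSingleton v hv (1 : ℂ)
      = ⟨v, Submodule.mem_span_singleton_self v⟩ := by
    ext; simp
  have h2 := L.extend_apply ⟨v, Submodule.mem_span_singleton_self v⟩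
  simp only [LinearIsometry.coe_toLinearIsometryEquiv]
  rw [h2, ← h1]
  change ((LinearIsometryEquiv.toSpanUnitSingleton w hw
    ((LinearIsometryEquiv.toSpanUnitSingleton v hv).symm
      (LinearIsometryEquiv.toSpanUnitSingleton v hv 1))) : E) = w
  rw [LinearIsometryEquiv.symm_apply_apply]
  simp

/-- A random unit vector whose law is invariant under all unitaries. -/
structure IsIsotropic {Ω : Type*} [MeasurableSpace Ω] (P : Measure Ω) (b : Ω → E) : Prop where
  norm_eq_one : ∀ ω, ‖b ω‖ = 1
  measurable_comp : ∀ h : E → ℝ, Continuous h → Measurable fun ω => h (b ω)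
  integral_comp : ∀ (V : E ≃ₗᵢ[ℂ] E) (h : E → ℝ), Continuous h →
    ∫ ω, h (V (b ω)) ∂P = ∫ ω, h (b ω) ∂P

namespace IsIsotropic

variable {Ω : Type*} [MeasurableSpace Ω] {P : Measure Ω} [IsProbabilityMeasure P] {b : Ω → E}

lemma integrable_comp (hb : IsIsotropic P b) {h : E → ℝ} (hh : Continuous h) :
    Integrable (fun ω => h (b ω)) P := by
  have : ProperSpace E := FiniteDimensional.proper ℂ E
  obtain ⟨C, hC⟩ := (isCompact_sphere (0 : E) 1).exists_bound_of_continuousOn hh.continuousOn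
  exact Integrable.of_bound (hb.measurable_comp h hh).aestronglyMeasurable C
    (ae_of_all _ fun ω => hC _ (by simp [hb.norm_eq_one]))

/-- The fourth moment of the component along `v`. -/
lemma exists_fourth_moment (hb : IsIsotropic P b) :
    ∃ q : ℝ, ∀ v : E, ∫ ω, ‖inner ℂ v (b ω)‖ ^ 4 ∂P = q * ‖v‖ ^ 4 := by
  obtain ⟨ω₀⟩ : Nonempty Ω := nonempty_of_isProbabilityMeasure P
  refine ⟨∫ ω, ‖inner ℂ (b ω₀) (b ω)‖ ^ 4 ∂P, fun v => ?_⟩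
  rcases eq_or_ne v 0 with rfl | hv
  · simp
  have hv' : ‖v‖ ≠ 0 := norm_ne_zero_iff.mpr hv
  have hu : ‖(((‖v‖⁻¹ : ℝ) : ℂ) • v)‖ = 1 := by
    rw [norm_smul, Complex.norm_real]; simp [hv']
  -- Any value of `b` serves as the reference unit vector; invariance under the unitary `V` moves
  -- every direction to it.
  obtain ⟨V, hV⟩ := exists_linearIsometryEquiv_apply_eq hu (hb.norm_eq_one ω₀)
  have h1 := hb.integral_comp V (fun x => ‖inner ℂ (b ω₀) x‖ ^ 4) (by fun_prop)
  rw [← h1, mul_comm, ← integral_const_mul]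
  refine integral_congr_ae (ae_of_all _ fun ω => ?_)
  simp only
  rw [← hV, V.inner_map_map, inner_smul_left, norm_mul, Complex.conj_ofReal, Complex.norm_real,
    norm_inv, norm_norm]
  field_simp

/-- Summing over the four phases ±1, ±i cancels all phase-dependent cross terms. -/
lemma sum_norm_add_pow_four (α β : ℂ) :
    ‖α + β‖ ^ 4 + ‖α - β‖ ^ 4 + ‖α + Complex.I * β‖ ^ 4 + ‖α - Complex.I * β‖ ^ 4
      = 4 * (‖α‖ ^ 4 + ‖β‖ ^ 4 + 4 * (‖α‖ ^ 2 * ‖β‖ ^ 2)) := by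
  have h : ∀ z : ℂ, ‖z‖ ^ 4 = (z.re * z.re + z.im * z.im) ^ 2 := by
    intro z
    rw [← Complex.normSq_apply, ← Complex.sq_norm]
    ring
  have h' : ∀ z : ℂ, ‖z‖ ^ 2 = z.re * z.re + z.im * z.im := by
    intro z
    rw [← Complex.normSq_apply, ← Complex.sq_norm]
  simp only [h, h', Complex.add_re, Complex.add_im, Complex.sub_re, Complex.sub_im, Complex.mul_re,
    Complex.mul_im, Complex.I_re, Complex.I_im]
  ring

/-- Polarization: the four vectors `v + t • w` with t = ±1, ±i have norm √2, so 4·4q = 4(2q + 4x)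
for the mixed moment x. -/
lemma mixed_moment (hb : IsIsotropic P b) {q : ℝ}
    (hq : ∀ v : E, ∫ ω, ‖inner ℂ v (b ω)‖ ^ 4 ∂P = q * ‖v‖ ^ 4) {v w : E} (hv : ‖v‖ = 1)
    (hw : ‖w‖ = 1) (hvw : inner ℂ v w = 0) :
    ∫ ω, ‖inner ℂ v (b ω)‖ ^ 2 * ‖inner ℂ w (b ω)‖ ^ 2 ∂P = q / 2 := by
  have hnorm : ∀ t : ℂ, ‖t‖ = 1 → ‖v + t • w‖ ^ 4 = 4 := by
    intro t ht
    have h1 : ‖v + t • w‖ ^ 2 = 2 := by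
      rw [@norm_add_sq ℂ, inner_smul_right, hvw, norm_smul, ht, hv, hw]
      norm_num
    rw [show (4 : ℕ) = 2 * 2 from rfl, pow_mul, h1]
    norm_num
  have hint : ∀ u : E, Integrable (fun ω => ‖inner ℂ u (b ω)‖ ^ 4) P := fun u =>
    hb.integrable_comp (h := fun x => ‖inner ℂ u x‖ ^ 4) (by fun_prop)
  have hint2 : Integrable (fun ω => ‖inner ℂ v (b ω)‖ ^ 2 * ‖inner ℂ w (b ω)‖ ^ 2) P :=
    hb.integrable_comp (h := fun x => ‖inner ℂ v x‖ ^ 2 * ‖inner ℂ w x‖ ^ 2) (by fun_prop)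
  have hsum : ∀ ω, ‖inner ℂ (v + (1 : ℂ) • w) (b ω)‖ ^ 4 + ‖inner ℂ (v + (-1 : ℂ) • w) (b ω)‖ ^ 4
      + ‖inner ℂ (v + (-Complex.I) • w) (b ω)‖ ^ 4 + ‖inner ℂ (v + Complex.I • w) (b ω)‖ ^ 4
      = 4 * (‖inner ℂ v (b ω)‖ ^ 4 + ‖inner ℂ w (b ω)‖ ^ 4
        + 4 * (‖inner ℂ v (b ω)‖ ^ 2 * ‖inner ℂ w (b ω)‖ ^ 2)) := by
    intro ω
    rw [← sum_norm_add_pow_four]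
    simp only [inner_add_left, inner_smul_left, map_one, map_neg, Complex.conj_I, one_mul, neg_neg,
      neg_mul, ← sub_eq_add_neg]
  have h := integral_congr_ae (μ := P) (ae_of_all _ hsum)
  have hadd2 : ∀ u u' : E, Integrable (fun ω => ‖inner ℂ u (b ω)‖ ^ 4
      + ‖inner ℂ u' (b ω)‖ ^ 4) P := fun u u' => (hint u).add (hint u')
  have hadd3 : ∀ u u' u'' : E, Integrable (fun ω => ‖inner ℂ u (b ω)‖ ^ 4
      + ‖inner ℂ u' (b ω)‖ ^ 4 + ‖inner ℂ u'' (b ω)‖ ^ 4) P :=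
    fun u u' u'' => (hadd2 u u').add (hint u'')
  rw [integral_add (hadd3 _ _ _) (hint _),
    integral_add (hadd2 _ _) (hint _), integral_add (hint _) (hint _),
    integral_const_mul, integral_add (hadd2 _ _) (hint2.const_mul 4),
    integral_add (hint _) (hint _), integral_const_mul] at h
  simp only [hq] at h
  rw [hnorm 1 (by simp), hnorm (-1) (by simp), hnorm (-Complex.I) (by simp),
    hnorm Complex.I (by simp), hv, hw] at h
  linarith

variable {ι : Type*} [Fintype ι]

lemma fourth_moment_eq (hb : IsIsotropic P b) {q : ℝ}
    (hq : ∀ v : E, ∫ ω, ‖inner ℂ v (b ω)‖ ^ 4 ∂P = q * ‖v‖ ^ 4) (e : OrthonormalBasis ι ℂ E)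
    (a : ι → ℝ) :
    ∫ ω, (∑ i, a i * ‖inner ℂ (e i) (b ω)‖ ^ 2) ^ 2 ∂P
      = q / 2 * (∑ i, a i ^ 2 + (∑ i, a i) ^ 2) := by
  classical
  have hr : ∀ i j, ∫ ω, ‖inner ℂ (e i) (b ω)‖ ^ 2 * ‖inner ℂ (e j) (b ω)‖ ^ 2 ∂P
      = q / 2 * (1 + if i = j then 1 else 0) := by
    intro i j
    split_ifs with hij
    · subst hij
      have := hq (e i)
      rw [e.norm_eq_one, one_pow, mul_one] at this
      rw [show q / 2 * (1 + 1) = q by ring, ← this]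
      refine integral_congr_ae (ae_of_all _ fun ω => ?_)
      simp only
      ring
    · rw [hb.mixed_moment hq (e.norm_eq_one i) (e.norm_eq_one j) (e.orthonormal.2 hij)]
      ring
  have hexp : ∀ ω, (∑ i, a i * ‖inner ℂ (e i) (b ω)‖ ^ 2) ^ 2
      = ∑ i, ∑ j, a i * a j * (‖inner ℂ (e i) (b ω)‖ ^ 2 * ‖inner ℂ (e j) (b ω)‖ ^ 2) := by
    intro ω
    rw [sq, Finset.sum_mul_sum]
    exact Finset.sum_congr rfl fun i _ => Finset.sum_congr rfl fun j _ => by ring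
  have hint : ∀ i j, Integrable (fun ω => a i * a j *
      (‖inner ℂ (e i) (b ω)‖ ^ 2 * ‖inner ℂ (e j) (b ω)‖ ^ 2)) P := fun i j =>
    hb.integrable_comp
      (h := fun x => a i * a j * (‖inner ℂ (e i) x‖ ^ 2 * ‖inner ℂ (e j) x‖ ^ 2)) (by fun_prop)
  simp_rw [hexp]
  rw [integral_finsetSum _ fun i _ => integrable_finsetSum _ fun j _ => hint i j]
  have h1 : ∀ i, ∫ ω, ∑ j, a i * a j * (‖inner ℂ (e i) (b ω)‖ ^ 2 * ‖inner ℂ (e j) (b ω)‖ ^ 2) ∂P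
      = q / 2 * (a i ^ 2 + a i * ∑ j, a j) := by
    intro i
    rw [integral_finsetSum _ fun j _ => hint i j]
    simp_rw [integral_const_mul, hr]
    simp only [mul_add, mul_one, mul_ite, mul_zero, Finset.sum_add_distrib, Finset.sum_ite_eq,
      Finset.mem_univ, if_true]
    rw [Finset.mul_sum, Finset.mul_sum, add_comm]
    congr 1
    · ring
    · exact Finset.sum_congr rfl fun j _ => by ring
  simp_rw [h1]
  rw [← Finset.mul_sum, Finset.sum_add_distrib, ← Finset.sum_mul, sq (∑ i, a i)]

/-- The variance of a diagonal quadratic form of an isotropic random unit vector. -/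
lemma integral_sq_sub_le (hb : IsIsotropic P b) (e : OrthonormalBasis ι ℂ E) (a : ι → ℝ) :
    ∫ ω, (∑ i, a i * ‖inner ℂ (e i) (b ω)‖ ^ 2 - (∑ i, a i) / Fintype.card ι) ^ 2 ∂P
      ≤ (∑ i, a i ^ 2) / (Fintype.card ι : ℝ) ^ 2 := by
  obtain ⟨q, hq⟩ := hb.exists_fourth_moment
  obtain ⟨ω₀⟩ : Nonempty Ω := nonempty_of_isProbabilityMeasure P
  have hsum1 : ∀ ω, ∑ i, ‖inner ℂ (e i) (b ω)‖ ^ 2 = 1 := by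
    intro ω
    rw [e.sum_sq_norm_inner_right, hb.norm_eq_one, one_pow]
  have hne : Nonempty ι := by
    by_contra hemp
    rw [not_nonempty_iff] at hemp
    simpa using hsum1 ω₀
  set d : ℝ := ((Fintype.card ι : ℕ) : ℝ) with hd
  have hd0 : 0 < d := by rw [hd]; exact_mod_cast Fintype.card_pos
  -- With all coefficients equal to 1 the form is constantly 1 on unit vectors, which determines
  -- `q`.
  have hq1 : q / 2 * (d + d ^ 2) = 1 := by
    have := hb.fourth_moment_eq hq e (fun _ => 1)
    simp only [one_mul, hsum1, one_pow, integral_const, probReal_univ, smul_eq_mul, mul_one,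
      Finset.sum_const, Finset.card_univ, nsmul_eq_mul] at this
    exact this.symm
  set t : ℝ := (∑ i, a i) / d with ht
  have hsumt : ∑ i, (a i - t) = 0 := by
    rw [Finset.sum_sub_distrib, Finset.sum_const, Finset.card_univ, nsmul_eq_mul, ← hd, ht,
      mul_div_cancel₀ _ hd0.ne', sub_self]
  -- Subtracting the mean from the coefficients centres the form and removes the squared-sum term of
  -- the fourth moment.
  have h1 : ∀ ω, (∑ i, a i * ‖inner ℂ (e i) (b ω)‖ ^ 2 - t) ^ 2
      = (∑ i, (a i - t) * ‖inner ℂ (e i) (b ω)‖ ^ 2) ^ 2 := by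
    intro ω
    simp_rw [sub_mul]
    rw [Finset.sum_sub_distrib, ← Finset.mul_sum, hsum1, mul_one]
  simp_rw [h1]
  rw [hb.fourth_moment_eq hq e, hsumt]
  have h2 : ∑ i, (a i - t) ^ 2 ≤ ∑ i, a i ^ 2 := by
    have : ∑ i, (a i - t) ^ 2 = ∑ i, a i ^ 2 - d * t ^ 2 := by
      have h3 : ∀ i, (a i - t) ^ 2 = a i ^ 2 - 2 * t * (a i - t) - t ^ 2 := fun i => by ring
      simp_rw [h3]
      rw [Finset.sum_sub_distrib, Finset.sum_sub_distrib, ← Finset.mul_sum, hsumt]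
      simp [hd]
    rw [this]
    nlinarith [sq_nonneg t]
  have hq0 : q / 2 = 1 / (d + d ^ 2) := by
    rw [eq_div_iff (by positivity)]; exact hq1
  rw [hq0, zero_pow two_ne_zero, add_zero, one_div, inv_mul_eq_div]
  refine div_le_div₀ (Finset.sum_nonneg fun _ _ => sq_nonneg _) h2 (by positivity) (by linarith)

end IsIsotropic

end Isotropic

/-! ### Variance of quadratic forms in terms of Hilbert–Schmidt norms -/

section HilbertSchmidt

variable {E : Type*} [NormedAddCommGroup E] [InnerProductSpace ℂ E] [FiniteDimensional ℂ E]
  {ι : Type*} [Fintype ι]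

/-- The squared Hilbert--Schmidt norm of an operator. -/
def hsSq (A : E →ₗ[ℂ] E) : ℝ := (LinearMap.trace ℂ E (A.adjoint ∘ₗ A)).re

lemma hsSq_eq_sum (A : E →ₗ[ℂ] E) (e : OrthonormalBasis ι ℂ E) :
    hsSq A = ∑ i, ‖A (e i)‖ ^ 2 := by
  rw [hsSq, LinearMap.trace_eq_sum_inner _ e, Complex.re_sum]
  refine Finset.sum_congr rfl fun i _ => ?_
  rw [LinearMap.comp_apply, LinearMap.adjoint_inner_right]
  exact inner_self_eq_norm_sq (𝕜 := ℂ) _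

lemma hsSq_adjoint (A : E →ₗ[ℂ] E) : hsSq A.adjoint = hsSq A := by
  rw [hsSq, hsSq, LinearMap.adjoint_adjoint]
  exact congrArg Complex.re (LinearMap.trace_mul_comm ℂ A A.adjoint)

lemma hsSq_add_le (A B : E →ₗ[ℂ] E) : hsSq (A + B) ≤ 2 * (hsSq A + hsSq B) := by
  rw [hsSq_eq_sum _ (stdOrthonormalBasis ℂ E), hsSq_eq_sum A (stdOrthonormalBasis ℂ E),
    hsSq_eq_sum B (stdOrthonormalBasis ℂ E), ← Finset.sum_add_distrib, Finset.mul_sum]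
  refine Finset.sum_le_sum fun i _ => ?_
  rw [LinearMap.add_apply]
  have h1 := norm_add_le (A (stdOrthonormalBasis ℂ E i)) (B (stdOrthonormalBasis ℂ E i))
  calc _ ≤ (‖A (stdOrthonormalBasis ℂ E i)‖ + ‖B (stdOrthonormalBasis ℂ E i)‖) ^ 2 := by gcongr
    _ ≤ _ := add_sq_le

lemma hsSq_smul (c : ℂ) (A : E →ₗ[ℂ] E) : hsSq (c • A) = ‖c‖ ^ 2 * hsSq A := by
  rw [hsSq_eq_sum _ (stdOrthonormalBasis ℂ E), hsSq_eq_sum A (stdOrthonormalBasis ℂ E),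
    Finset.mul_sum]
  simp [norm_smul, mul_pow]

variable {Ω : Type*} [MeasurableSpace Ω] {P : Measure Ω} [IsProbabilityMeasure P] {b : Ω → E}

/-- In an eigenbasis the form is diagonal, with the eigenvalues as coefficients. -/
lemma IsIsotropic.integral_sq_sub_le_of_isSymmetric (hb : IsIsotropic P b) {X : E →ₗ[ℂ] E}
    (hX : X.IsSymmetric) :
    ∫ ω, ((inner ℂ (b ω) (X (b ω))).re
        - (LinearMap.trace ℂ E X).re / Module.finrank ℂ E) ^ 2 ∂P
      ≤ hsSq X / (Module.finrank ℂ E : ℝ) ^ 2 := by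
  set e := hX.eigenvectorBasis rfl with he
  set a := hX.eigenvalues rfl with ha
  have hXe : ∀ i, X (e i) = (a i : ℂ) • e i := fun i => hX.apply_eigenvectorBasis rfl i
  have h1 : ∀ x : E, (inner ℂ x (X x)).re = ∑ i, a i * ‖inner ℂ (e i) x‖ ^ 2 := by
    intro x
    rw [← e.sum_inner_mul_inner, Complex.re_sum]
    refine Finset.sum_congr rfl fun i _ => ?_
    rw [← hX (e i) x, hXe, inner_smul_left, Complex.conj_ofReal, ← inner_conj_symm x (e i),
      mul_left_comm, ← Complex.normSq_eq_conj_mul_self, Complex.normSq_eq_norm_sq,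
      ← Complex.ofReal_mul, Complex.ofReal_re]
  have h2 : (LinearMap.trace ℂ E X).re = ∑ i, a i := by
    rw [LinearMap.trace_eq_sum_inner _ e, Complex.re_sum]
    refine Finset.sum_congr rfl fun i _ => ?_
    rw [hXe, inner_smul_right, inner_self_eq_norm_sq_to_K, e.norm_eq_one]
    simp
  have h3 : hsSq X = ∑ i, a i ^ 2 := by
    rw [hsSq_eq_sum _ e]
    refine Finset.sum_congr rfl fun i _ => ?_
    rw [hXe, norm_smul, e.norm_eq_one, mul_one, Complex.norm_real, Real.norm_eq_abs, sq_abs]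
  have := hb.integral_sq_sub_le e a
  rw [Fintype.card_fin] at this
  simp_rw [h1, h2, h3]
  exact this

/-- The variance of the quadratic form of an operator evaluated at an isotropic random unit vector
is bounded by its squared Hilbert--Schmidt norm. -/
lemma IsIsotropic.integral_norm_sq_sub_le (hb : IsIsotropic P b) (A : E →ₗ[ℂ] E) :
    ∫ ω, ‖inner ℂ (b ω) (A (b ω)) - LinearMap.trace ℂ E A / Module.finrank ℂ E‖ ^ 2 ∂P
      ≤ 2 * hsSq A / (Module.finrank ℂ E : ℝ) ^ 2 := by
  set d : ℝ := ((Module.finrank ℂ E : ℕ) : ℝ) with hd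
  have htr : LinearMap.trace ℂ E A.adjoint = (starRingEnd ℂ) (LinearMap.trace ℂ E A) := by
    rw [LinearMap.trace_eq_sum_inner _ (stdOrthonormalBasis ℂ E),
      LinearMap.trace_eq_sum_inner _ (stdOrthonormalBasis ℂ E), map_sum]
    refine Finset.sum_congr rfl fun i _ => ?_
    rw [LinearMap.adjoint_inner_right, inner_conj_symm]
  have hin : ∀ x : E, inner ℂ x (A.adjoint x) = (starRingEnd ℂ) (inner ℂ x (A x)) := by
    intro x
    rw [LinearMap.adjoint_inner_right, inner_conj_symm]
  -- `X` and `Y` are twice the self-adjoint real and imaginary parts of `A`, which accounts for the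
  -- division by 4 below.
  let X := A + A.adjoint
  let Y := (-Complex.I) • A + Complex.I • A.adjoint
  have hX : X.IsSymmetric := by
    intro x y
    simp only [X, LinearMap.add_apply, inner_add_left, inner_add_right,
      LinearMap.adjoint_inner_left, LinearMap.adjoint_inner_right]
    ring
  have hY : Y.IsSymmetric := by
    intro x y
    simp only [Y, LinearMap.add_apply, LinearMap.smul_apply, inner_add_left, inner_add_right,
      LinearMap.adjoint_inner_left, LinearMap.adjoint_inner_right, inner_smul_left,
      inner_smul_right, map_neg, Complex.conj_I]
    ring
  have hXs : hsSq X ≤ 4 * hsSq A := by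
    have := hsSq_add_le A A.adjoint
    rw [hsSq_adjoint] at this
    linarith
  have hYs : hsSq Y ≤ 4 * hsSq A := by
    have := hsSq_add_le ((-Complex.I) • A) (Complex.I • A.adjoint)
    rw [hsSq_smul, hsSq_smul, hsSq_adjoint] at this
    simp only [norm_neg, Complex.norm_I] at this
    linarith
  have h1 := hb.integral_sq_sub_le_of_isSymmetric hX
  have h2 := hb.integral_sq_sub_le_of_isSymmetric hY
  rw [← hd] at h1 h2
  have hpt : ∀ ω, ‖inner ℂ (b ω) (A (b ω)) - LinearMap.trace ℂ E A / Module.finrank ℂ E‖ ^ 2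
      = (((inner ℂ (b ω) (X (b ω))).re - (LinearMap.trace ℂ E X).re / d) ^ 2
        + ((inner ℂ (b ω) (Y (b ω))).re - (LinearMap.trace ℂ E Y).re / d) ^ 2) / 4 := by
    intro ω
    have hdc : ((Module.finrank ℂ E : ℕ) : ℂ) = (d : ℂ) := by rw [hd]; simp
    rw [hdc, Complex.sq_norm, Complex.normSq_apply]
    simp only [X, Y, LinearMap.add_apply, LinearMap.smul_apply, inner_add_right, inner_smul_right,
      map_add, map_smul, smul_eq_mul, hin, htr, Complex.add_re, Complex.mul_re, Complex.neg_re,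
      Complex.I_re, Complex.I_im, Complex.neg_im, Complex.conj_re, Complex.conj_im,
      Complex.sub_re, Complex.sub_im, Complex.div_ofReal_re, Complex.div_ofReal_im]
    ring
  simp_rw [hpt]
  have hi : ∀ Z : E →ₗ[ℂ] E, Integrable (fun ω => ((inner ℂ (b ω) (Z (b ω))).re
      - (LinearMap.trace ℂ E Z).re / d) ^ 2) P := by
    intro Z
    have hZ : Continuous Z := Z.continuous_of_finiteDimensional
    exact hb.integrable_comp (h := fun x => ((inner ℂ x (Z x)).re
      - (LinearMap.trace ℂ E Z).re / d) ^ 2)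
      (((Complex.continuous_re.comp (continuous_id.inner hZ)).sub continuous_const).pow 2)
  rw [integral_div, integral_add (hi X) (hi Y)]
  have h3 : hsSq X / d ^ 2 ≤ 4 * hsSq A / d ^ 2 := by gcongr
  have h4 : hsSq Y / d ^ 2 ≤ 4 * hsSq A / d ^ 2 := by gcongr
  have h5 : 2 * hsSq A / d ^ 2 = (4 * hsSq A / d ^ 2 + 4 * hsSq A / d ^ 2) / 4 := by ring
  linarith

end HilbertSchmidt

/-! ### Vectors of a uniformly random basis -/

section UniformONB

variable {E : Type*} [NormedAddCommGroup E] [InnerProductSpace ℂ E] [CompleteSpace E]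
  [FiniteDimensional ℂ E]

lemma continuous_orthonormalBasis_apply {E : Type*} [NormedAddCommGroup E] [InnerProductSpace ℂ E]
    (n : Fin (Module.finrank ℂ E)) :
    Continuous fun B : OrthonormalBasis (Fin (Module.finrank ℂ E)) ℂ E => B n :=
  (continuous_apply n).comp continuous_induced_dom

instance : SecondCountableTopology (OrthonormalBasis (Fin (Module.finrank ℂ E)) ℂ E) := by
  have : ProperSpace E := FiniteDimensional.proper ℂ E
  exact Topology.IsInducing.secondCountableTopology (f := fun B n => B n) ⟨rfl⟩

lemma continuous_unitary_map_basis :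
    Continuous fun U : unitary (E →L[ℂ] E) =>
      (stdOrthonormalBasis ℂ E).map (Unitary.linearIsometryEquiv U) := by
  refine continuous_induced_rng.mpr (continuous_pi fun n => ?_)
  have : ∀ U : unitary (E →L[ℂ] E),
      (stdOrthonormalBasis ℂ E).map (Unitary.linearIsometryEquiv U) n
        = (U : E →L[ℂ] E) (stdOrthonormalBasis ℂ E n) := fun U => by
    rw [OrthonormalBasis.map_apply]
    rfl
  simp only [Function.comp_def, this]
  exact (ContinuousLinearMap.apply ℂ E (stdOrthonormalBasis ℂ E n)).continuous.comp
    continuous_subtype_val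

instance : IsProbabilityMeasure (uONB E) := by
  have : IsProbabilityMeasure (Measure.haarMeasure
      (⊤ : TopologicalSpace.PositiveCompacts (unitary (E →L[ℂ] E)))) :=
    ⟨Measure.haarMeasure_self⟩
  exact Measure.isProbabilityMeasure_map continuous_unitary_map_basis.measurable.aemeasurable

/-- Applying `V` to the basis vector multiplies the Haar unitary by `V` from the left, which
preserves Haar measure. -/
lemma isIsotropic_uONB (n : Fin (Module.finrank ℂ E)) :
    IsIsotropic (uONB E) (fun B => B n) where
  norm_eq_one B := B.norm_eq_one n
  measurable_comp h hh := (hh.comp (continuous_orthonormalBasis_apply n)).measurable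
  integral_comp V h hh := by
    have hm := (continuous_unitary_map_basis (E := E)).measurable.aemeasurable
      (μ := Measure.haarMeasure (⊤ : TopologicalSpace.PositiveCompacts (unitary (E →L[ℂ] E))))
    rw [uONB, integral_map hm (f := fun B => h (V (B n)))
      ((hh.comp V.continuous).comp (continuous_orthonormalBasis_apply n)).aestronglyMeasurable,
      integral_map hm (f := fun B => h (B n)) (hh.comp (continuous_orthonormalBasis_apply n)).aestronglyMeasurable]
    rw [← integral_mul_left_eq_self (fun U : unitary (E →L[ℂ] E) =>
      h ((stdOrthonormalBasis ℂ E).map (Unitary.linearIsometryEquiv U) n))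
      (Unitary.linearIsometryEquiv.symm V)]
    simp

end UniformONB

/-- Replaces a factor with dim H columns by a square one of the same covariance, so that the
compactness constant is independent of `Hb`. -/
lemma exists_square_root {k κ : Type*} [Fintype k] [DecidableEq k] [Fintype κ] (T : Matrix k κ ℂ) :
    ∃ S : Matrix k k ℂ, S * S.conjTranspose = T * T.conjTranspose := by
  open scoped MatrixOrder ComplexOrder Matrix.Norms.L2Operator in
  obtain ⟨B, hB⟩ := CStarAlgebra.nonneg_iff_eq_star_mul_self.mp
    (Matrix.posSemidef_self_mul_conjTranspose T).nonneg
  refine ⟨B.conjTranspose, ?_⟩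
  rw [Matrix.conjTranspose_conjTranspose, hB]
  rfl

/-! ### Density matrices and their Gaussian vectors -/

namespace DensityMatrix

variable {H : Type*} [NormedAddCommGroup H] [InnerProductSpace ℂ H] [FiniteDimensional ℂ H]

lemma eigenvalue_nonneg (ρ : DensityMatrix H) (n) : 0 ≤ ρ.eigenvalue n :=
  ρ.isPositive.toLinearMap.nonneg_eigenvalues rfl n

lemma op_eigenbasis (ρ : DensityMatrix H) (n) :
    ρ.op (ρ.eigenbasis n) = (ρ.eigenvalue n : ℂ) • ρ.eigenbasis n :=
  ρ.isPositive.isSymmetric.apply_eigenvectorBasis rfl n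

lemma sum_eigenvalue (ρ : DensityMatrix H) : ∑ n, ρ.eigenvalue n = 1 := by
  have h := ρ.trace_eq_one
  rw [LinearMap.trace_eq_sum_inner _ ρ.eigenbasis] at h
  have h1 : ∀ n, inner ℂ (ρ.eigenbasis n) ((ρ.op : H →ₗ[ℂ] H) (ρ.eigenbasis n))
      = (ρ.eigenvalue n : ℂ) := by
    intro n
    rw [ContinuousLinearMap.coe_coe, op_eigenbasis, inner_smul_right,
      inner_self_eq_norm_sq_to_K, ρ.eigenbasis.norm_eq_one]
    simp
  simp_rw [h1] at h
  exact_mod_cast h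

lemma eigenvalue_le_norm (ρ : DensityMatrix H) (n) : ρ.eigenvalue n ≤ ‖ρ.op‖ := by
  have h := ρ.op.le_opNorm (ρ.eigenbasis n)
  rwa [op_eigenbasis, norm_smul, ρ.eigenbasis.norm_eq_one, mul_one, mul_one, Complex.norm_real,
    Real.norm_eq_abs, abs_of_nonneg (ρ.eigenvalue_nonneg n)] at h

/-- tr ρ² ≤ ‖ρ‖ tr ρ. This is how a small operator norm makes the fluctuations small. -/
lemma hsSq_op_le (ρ : DensityMatrix H) : hsSq (ρ.op : H →ₗ[ℂ] H) ≤ ‖ρ.op‖ := by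
  rw [hsSq_eq_sum _ ρ.eigenbasis]
  calc ∑ n, ‖(ρ.op : H →ₗ[ℂ] H) (ρ.eigenbasis n)‖ ^ 2 = ∑ n, ρ.eigenvalue n * ρ.eigenvalue n := by
        refine Finset.sum_congr rfl fun n _ => ?_
        rw [ContinuousLinearMap.coe_coe, op_eigenbasis, norm_smul, ρ.eigenbasis.norm_eq_one, mul_one,
          Complex.norm_real, Real.norm_eq_abs, sq_abs, sq]
    _ ≤ ∑ n, ‖ρ.op‖ * ρ.eigenvalue n := Finset.sum_le_sum fun n _ =>
        mul_le_mul_of_nonneg_right (ρ.eigenvalue_le_norm n) (ρ.eigenvalue_nonneg n)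
    _ = ‖ρ.op‖ := by rw [← Finset.mul_sum, sum_eigenvalue, mul_one]

/-- The Gaussian vector `∑ n, √p_n z_n |n⟩` as a function of a standard Gaussian family `z`. -/
def gaussianVector (ρ : DensityMatrix H) (z : Fin (Module.finrank ℂ H) → ℂ) : H :=
  ∑ n, ((Real.sqrt (ρ.eigenvalue n) : ℂ) * z n) • ρ.eigenbasis n

lemma continuous_gaussianVector (ρ : DensityMatrix H) : Continuous ρ.gaussianVector := by
  unfold gaussianVector; fun_prop

lemma norm_gaussianVector_sq (ρ : DensityMatrix H) (z) :
    ‖ρ.gaussianVector z‖ ^ 2 = ∑ n, ρ.eigenvalue n * ‖z n‖ ^ 2 := by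
  rw [gaussianVector, ← ρ.eigenbasis.sum_sq_norm_inner_right]
  refine Finset.sum_congr rfl fun n _ => ?_
  rw [ρ.eigenbasis.orthonormal.inner_right_fintype, norm_mul, mul_pow, Complex.norm_real,
    Real.norm_eq_abs, sq_abs, Real.sq_sqrt (ρ.eigenvalue_nonneg n)]

variable {ι ι' : Type*}

/-- The matrix expressing the inner products with the vectors `u i` of the Gaussian vector in terms
of the standard Gaussian family. -/
def innerMatrix (ρ : DensityMatrix H) (u : ι → H) : Matrix ι (Fin (Module.finrank ℂ H)) ℂ :=
  fun i n => Real.sqrt (ρ.eigenvalue n) * inner ℂ (u i) (ρ.eigenbasis n)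

lemma innerMatrix_mulVec (ρ : DensityMatrix H) (u : ι → H) (z) :
    (ρ.innerMatrix u).mulVec z = fun i => inner ℂ (u i) (ρ.gaussianVector z) := by
  funext i
  rw [gaussianVector, inner_sum, Matrix.mulVec, dotProduct]
  refine Finset.sum_congr rfl fun n _ => ?_
  rw [inner_smul_right, innerMatrix]
  ring

/-- The covariance operator of the Gaussian vector is ρ. -/
lemma innerMatrix_mul_conjTranspose (ρ : DensityMatrix H) (u : ι → H) (v : ι' → H) (i : ι) (j : ι') :
    (ρ.innerMatrix u * (ρ.innerMatrix v).conjTranspose) i j = inner ℂ (u i) (ρ.op (v j)) := by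
  rw [← ρ.eigenbasis.sum_inner_mul_inner, Matrix.mul_apply]
  refine Finset.sum_congr rfl fun n _ => ?_
  have h1 : inner ℂ (ρ.eigenbasis n) (ρ.op (v j))
      = (ρ.eigenvalue n : ℂ) * inner ℂ (ρ.eigenbasis n) (v j) := by
    have := ρ.isPositive.isSymmetric (ρ.eigenbasis n) (v j)
    rw [ContinuousLinearMap.coe_coe] at this
    rw [← this, op_eigenbasis, inner_smul_left, Complex.conj_ofReal]
  have h2 : (ρ.eigenvalue n : ℂ) = Real.sqrt (ρ.eigenvalue n) * Real.sqrt (ρ.eigenvalue n) := by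
    rw [← Complex.ofReal_mul, Real.mul_self_sqrt (ρ.eigenvalue_nonneg n)]
  rw [h1, h2, Matrix.conjTranspose_apply, innerMatrix, innerMatrix, star_mul', Complex.star_def,
    Complex.conj_ofReal, inner_conj_symm]
  ring

variable [MeasurableSpace H] [BorelSpace H]

lemma gaussian_eq_map (ρ : DensityMatrix H) :
    ρ.gaussian = (standardGaussian _).map ρ.gaussianVector := by
  have h : Measure.pi (fun n => complexGaussian (ρ.eigenvalue n).toNNReal)
      = (standardGaussian (Fin (Module.finrank ℂ H))).map
        (fun z n => (Real.sqrt (ρ.eigenvalue n) : ℂ) * z n) := by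
    have h1 : ∀ n, IsProbabilityMeasure ((complexGaussian 1).map
        (fun z => (Real.sqrt (ρ.eigenvalue n) : ℂ) * z)) := fun n =>
      Measure.isProbabilityMeasure_map (by fun_prop)
    rw [standardGaussian, Measure.pi_map_pi
      (f := fun n z => (Real.sqrt (ρ.eigenvalue n) : ℂ) * z) (fun n => by fun_prop)]
    congr 1
    funext n
    rw [complexGaussian_eq_map, Real.coe_toNNReal _ (ρ.eigenvalue_nonneg n)]
  have hc : Continuous fun z : Fin (Module.finrank ℂ H) → ℂ => ∑ n, z n • ρ.eigenbasis n := by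
    fun_prop
  rw [gaussian, h, Measure.map_map hc.measurable (by fun_prop)]
  rfl

instance (ρ : DensityMatrix H) : IsProbabilityMeasure ρ.gaussian := by
  rw [gaussian_eq_map]
  exact Measure.isProbabilityMeasure_map ρ.continuous_gaussianVector.measurable.aemeasurable

lemma integral_gaussian (ρ : DensityMatrix H) {q : H → ℝ} (hq : Continuous q) :
    ∫ ψ, q ψ ∂ρ.gaussian = ∫ z, q (ρ.gaussianVector z) ∂standardGaussian _ := by
  rw [gaussian_eq_map, integral_map ρ.continuous_gaussianVector.measurable.aemeasurable
    hq.aestronglyMeasurable]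

lemma integrable_gaussian_iff (ρ : DensityMatrix H) {q : H → ℝ} (hq : Continuous q) :
    Integrable q ρ.gaussian ↔
      Integrable (fun z => q (ρ.gaussianVector z)) (standardGaussian _) := by
  rw [gaussian_eq_map, integrable_map_measure hq.aestronglyMeasurable
    ρ.continuous_gaussianVector.measurable.aemeasurable]
  rfl

lemma integrable_eval_sq (κ : Type*) [Fintype κ] (n : κ) :
    Integrable (fun z : κ → ℂ => ‖z n‖ ^ 2) (standardGaussian κ) :=
  integrable_comp_eval (μ := fun _ : κ => complexGaussian 1) (f := fun x : ℂ => ‖x‖ ^ 2)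
    (integrable_norm_pow_complexGaussian 1 2)

lemma integrable_norm_sq_gaussian (ρ : DensityMatrix H) :
    Integrable (fun ψ => ‖ψ‖ ^ 2) ρ.gaussian := by
  rw [integrable_gaussian_iff _ (by fun_prop)]
  simp_rw [norm_gaussianVector_sq]
  exact integrable_finsetSum _ fun n _ => (integrable_eval_sq _ n).const_mul _

lemma integral_norm_sq_gaussian (ρ : DensityMatrix H) : ∫ ψ, ‖ψ‖ ^ 2 ∂ρ.gaussian = 1 := by
  rw [integral_gaussian _ (by fun_prop)]
  simp_rw [norm_gaussianVector_sq]
  rw [integral_finsetSum _ fun n _ => (integrable_eval_sq _ n).const_mul _]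
  have h : ∀ n, ∫ z, ‖z n‖ ^ 2 ∂standardGaussian (Fin (Module.finrank ℂ H)) = 1 := by
    intro n
    rw [standardGaussian, integral_comp_eval (μ := fun _ => complexGaussian 1)
      (f := fun x : ℂ => ‖x‖ ^ 2) (by fun_prop), integral_norm_sq_complexGaussian]
    simp
  simp_rw [integral_const_mul, h, mul_one, sum_eigenvalue]

lemma integral_gaussian_inner (ρ : DensityMatrix H) (u : ι → H) {q : (ι → ℂ) → ℝ}
    (hq : Continuous q) :
    ∫ ψ, q (fun i => inner ℂ (u i) ψ) ∂ρ.gaussian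
      = ∫ z, q ((ρ.innerMatrix u).mulVec z) ∂standardGaussian _ := by
  rw [ρ.integral_gaussian (q := fun ψ => q fun i => inner ℂ (u i) ψ)
    (hq.comp (by fun_prop : Continuous fun ψ i => inner ℂ (u i) ψ))]
  simp_rw [innerMatrix_mulVec]

lemma integrable_gaussian_inner (ρ : DensityMatrix H) (u : ι → H) {q : (ι → ℂ) → ℝ}
    (hq : Continuous q) (hh : ∀ (t : ℝ) v, 0 ≤ t → q (t • v) = t ^ 4 * q v) :
    Integrable (fun ψ => q (fun i => inner ℂ (u i) ψ)) ρ.gaussian := by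
  rw [ρ.integrable_gaussian_iff (q := fun ψ => q fun i => inner ℂ (u i) ψ)
    (hq.comp (by fun_prop : Continuous fun ψ i => inner ℂ (u i) ψ))]
  simp_rw [← innerMatrix_mulVec]
  refine integrable_standardGaussian
    (hq.comp (Continuous.matrix_mulVec continuous_const continuous_id)) fun t v ht => ?_
  rw [Matrix.mulVec_smul, hh t _ ht]

end DensityMatrix

/-! ### Second moment of the fluctuation for a fixed basis -/

section SecondMoment

/-- A block diagonal matrix drives the two halves by independent families, so the mean of the
product factors. -/
lemma integral_fromBlocks_diagonal {ι : Type*} [Fintype ι] {G : (ι → ℂ) → ℝ} (s : Matrix ι ι ℂ) :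
    ∫ z, G (fun i => (Matrix.fromBlocks s 0 0 s).mulVec z (Sum.inl i)) *
        G (fun i => (Matrix.fromBlocks s 0 0 s).mulVec z (Sum.inr i)) ∂standardGaussian (ι ⊕ ι)
      = (∫ z, G (s.mulVec z) ∂standardGaussian ι) ^ 2 := by
  have hmp := measurePreserving_sumPiEquivProdPi (X := fun _ : ι ⊕ ι => ℂ)
    (fun _ => complexGaussian 1)
  have h1 : ∀ z : ι ⊕ ι → ℂ, G (fun i => (Matrix.fromBlocks s 0 0 s).mulVec z (Sum.inl i)) *
        G (fun i => (Matrix.fromBlocks s 0 0 s).mulVec z (Sum.inr i))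
      = (fun p : (ι → ℂ) × (ι → ℂ) => G (s.mulVec p.1) * G (s.mulVec p.2))
          (MeasurableEquiv.sumPiEquivProdPi (fun _ : ι ⊕ ι => ℂ) z) := by
    intro z
    simp only [Matrix.fromBlocks_mulVec, Matrix.zero_mulVec, add_zero, zero_add, Sum.elim_inl,
      Sum.elim_inr]
    rfl
  simp_rw [h1]
  rw [standardGaussian, hmp.integral_comp (MeasurableEquiv.measurableEmbedding _)
    (fun p : (ι → ℂ) × (ι → ℂ) => G (s.mulVec p.1) * G (s.mulVec p.2)),
    integral_prod_mul (f := fun z => G (s.mulVec z)) (g := fun z => G (s.mulVec z)), sq]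
  rfl

lemma frobSq_fromBlocks {m n m' n' : Type*} [Fintype m] [Fintype n] [Fintype m'] [Fintype n']
    (A : Matrix m n ℂ) (B : Matrix m n' ℂ) (C : Matrix m' n ℂ) (D : Matrix m' n' ℂ) :
    frobSq (Matrix.fromBlocks A B C D) = frobSq A + frobSq B + frobSq C + frobSq D := by
  simp only [frobSq, Fintype.sum_sum_type, Matrix.fromBlocks_apply₁₁, Matrix.fromBlocks_apply₁₂,
    Matrix.fromBlocks_apply₂₁, Matrix.fromBlocks_apply₂₂, Finset.sum_add_distrib]
  ring

variable {ι : Type*} [Fintype ι]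

variable {Ha Hb : Type*} [NormedAddCommGroup Ha] [InnerProductSpace ℂ Ha]
  [NormedAddCommGroup Hb] [InnerProductSpace ℂ Hb] [FiniteDimensional ℂ Ha] [FiniteDimensional ℂ Hb]
  {d : ℕ}

/-- The blocks `⟨m|ρ|m'⟩` of a density matrix, in coordinates. -/
def block (ρ : DensityMatrix (Ha ⊗[ℂ] Hb)) (e : OrthonormalBasis ι ℂ Ha) (y y' : Hb) :
    Matrix ι ι ℂ :=
  Matrix.of fun i j => inner ℂ (e i ⊗ₜ[ℂ] y) (ρ.op (e j ⊗ₜ[ℂ] y'))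

/-- The matrix of the reduced density matrix. -/
def reducedMatrix (ρ : DensityMatrix (Ha ⊗[ℂ] Hb)) (e : OrthonormalBasis ι ℂ Ha) : Matrix ι ι ℂ :=
  Matrix.of fun i j => inner ℂ (e i) (ρ.reduced.op (e j))

/-- The deviation of the blocks of `ρ` from those of a product with the maximally mixed state. -/
def deviation (ρ : DensityMatrix (Ha ⊗[ℂ] Hb)) (e : OrthonormalBasis ι ℂ Ha)
    (B : OrthonormalBasis (Fin d) ℂ Hb) (m m' : Fin d) : ℝ :=
  frobSq (block ρ e (B m) (B m) - (d : ℂ)⁻¹ • reducedMatrix ρ e) + frobSq (block ρ e (B m) (B m'))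
    + frobSq (block ρ e (B m') (B m))
    + frobSq (block ρ e (B m') (B m') - (d : ℂ)⁻¹ • reducedMatrix ρ e)

lemma deviation_nonneg (ρ : DensityMatrix (Ha ⊗[ℂ] Hb)) (e : OrthonormalBasis ι ℂ Ha)
    (B : OrthonormalBasis (Fin d) ℂ Hb) (m m' : Fin d) : 0 ≤ deviation ρ e B m m' :=
  add_nonneg (add_nonneg (add_nonneg (frobSq_nonneg _) (frobSq_nonneg _)) (frobSq_nonneg _))
    (frobSq_nonneg _)

end SecondMoment

universe u v

section SecondMomentBound

variable {Ha : Type u} [NormedAddCommGroup Ha] [InnerProductSpace ℂ Ha] [FiniteDimensional ℂ Ha]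
  [MeasurableSpace Ha] [BorelSpace Ha] {ι : Type*} [Fintype ι] [DecidableEq ι]

/-- For a function `G` of degree `2` with mean zero under the Gaussian measure of the reduced density
matrix, the second moment of `∑ m, G (⟨m|Ψ⟩)` is controlled by the deviations. -/
lemma exists_integral_sum_sq_le (e : OrthonormalBasis ι ℂ Ha) {G : ℝ → (ι → ℂ) → ℝ}
    (hc : Continuous fun p : ℝ × (ι → ℂ) => G p.1 p.2)
    (hh : ∀ c (t : ℝ) v, 0 ≤ t → G c (t • v) = t ^ 2 * G c v) (M : ℝ) {η : ℝ} (hη : 0 < η) :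
    ∃ C, 0 ≤ C ∧ ∀ c, |c| ≤ M → ∀ (Hb : Type v) [NormedAddCommGroup Hb] [InnerProductSpace ℂ Hb]
      [FiniteDimensional ℂ Hb] (ρ : DensityMatrix (Ha ⊗[ℂ] Hb)) (d : ℕ)
      (B : OrthonormalBasis (Fin d) ℂ Hb),
      ∫ φ, G c (fun i => inner ℂ (e i) φ) ∂ρ.reduced.gaussian = 0 →
      Integrable (fun ψ => (∑ m, G c (fun i => inner ℂ (e i ⊗ₜ[ℂ] B m) ψ)) ^ 2) ρ.gaussian ∧
      ∫ ψ, (∑ m, G c (fun i => inner ℂ (e i ⊗ₜ[ℂ] B m) ψ)) ^ 2 ∂ρ.gaussian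
        ≤ η * 4 + C * ∑ m, ∑ m', deviation ρ e B m m' := by
  -- One pair (m, m') contributes a function of degree 4 of the joint vector of partial inner
  -- products.
  let h : ℝ → (ι ⊕ ι → ℂ) → ℝ := fun c w =>
    G c (fun i => w (Sum.inl i)) * G c (fun i => w (Sum.inr i))
  have hcont : Continuous fun p : ℝ × (ι ⊕ ι → ℂ) => h p.1 p.2 :=
    (hc.comp (by fun_prop : Continuous fun p : ℝ × (ι ⊕ ι → ℂ) =>
      (p.1, fun i => p.2 (Sum.inl i)))).mul
    (hc.comp (by fun_prop : Continuous fun p : ℝ × (ι ⊕ ι → ℂ) =>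
      (p.1, fun i => p.2 (Sum.inr i))))
  have hhom : ∀ c (t : ℝ) v, 0 ≤ t → h c (t • v) = t ^ 4 * h c v := by
    intro c t v ht
    have h1 := hh c t (fun i => v (Sum.inl i)) ht
    have h2 := hh c t (fun i => v (Sum.inr i)) ht
    change G c (t • fun i => v (Sum.inl i)) * G c (t • fun i => v (Sum.inr i)) = _
    rw [h1, h2]
    ring
  obtain ⟨C, hC0, hC⟩ := exists_abs_integral_sub_le hcont hhom M hη
  refine ⟨C, hC0, fun c hcM Hb _ _ _ ρ d B hmean => ?_⟩
  have hcc : Continuous (G c) := hc.comp (by fun_prop : Continuous fun z => (c, z))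
  have hhc : Continuous (h c) := hcont.comp (by fun_prop : Continuous fun z => (c, z))
  let w : Fin d → Fin d → ι ⊕ ι → Ha ⊗[ℂ] Hb := fun m m' =>
    Sum.elim (fun i => e i ⊗ₜ[ℂ] B m) (fun i => e i ⊗ₜ[ℂ] B m')
  have hexp : ∀ ψ : Ha ⊗[ℂ] Hb, (∑ m, G c (fun i => inner ℂ (e i ⊗ₜ[ℂ] B m) ψ)) ^ 2
      = ∑ m, ∑ m', h c (fun k => inner ℂ (w m m' k) ψ) := by
    intro ψ
    rw [sq, Finset.sum_mul_sum]
    rfl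
  have hint : ∀ m m', Integrable (fun ψ => h c (fun k => inner ℂ (w m m' k) ψ)) ρ.gaussian :=
    fun m m' => ρ.integrable_gaussian_inner (w m m') hhc (hhom c)
  simp_rw [hexp]
  refine ⟨integrable_finsetSum _ fun m _ => integrable_finsetSum _ fun m' _ => hint m m', ?_⟩
  rw [integral_finsetSum _ fun m _ => integrable_finsetSum _ fun m' _ => hint m m']
  simp_rw [integral_finsetSum _ fun m' _ => hint _ m']
  obtain ⟨s, hs⟩ := exists_square_root (ρ.reduced.innerMatrix e)
  have hsσ : s * s.conjTranspose = reducedMatrix ρ e := by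
    rw [hs]
    ext i j
    rw [DensityMatrix.innerMatrix_mul_conjTranspose]
    rfl
  have hsmean : ∫ z, G c (s.mulVec z) ∂standardGaussian ι = 0 := by
    rw [integral_mulVec_eq hs hcc, ← DensityMatrix.integral_gaussian_inner _ _ hcc, hmean]
  have hstr : frobSq s = 1 := by
    have h1 := frobSq_eq_trace s
    have h2 := ρ.reduced.trace_eq_one
    rw [LinearMap.trace_eq_sum_inner _ e] at h2
    rw [hsσ] at h1
    have : (reducedMatrix ρ e).trace = 1 := h2
    rw [this] at h1
    exact_mod_cast h1
  rcases Nat.eq_zero_or_pos d with rfl | hd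
  · simp
    positivity
  have hd' : (0 : ℝ) < d := by exact_mod_cast hd
  -- With this scaling `S₀` has covariance diag(σ/d, σ/d), that of two independent conditional
  -- vectors, each carrying its equal share of the trace.
  set t : ℝ := (Real.sqrt d)⁻¹ with ht
  have ht0 : 0 ≤ t := by positivity
  have ht2 : t ^ 2 = (d : ℝ)⁻¹ := by rw [ht, inv_pow, Real.sq_sqrt hd'.le]
  set S₀ : Matrix (ι ⊕ ι) (ι ⊕ ι) ℂ := (t : ℂ) • Matrix.fromBlocks s 0 0 s with hS₀
  have hS₀int : ∫ z, h c (S₀.mulVec z) ∂standardGaussian (ι ⊕ ι) = 0 := by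
    rw [hS₀, integral_smul_mulVec hhom c ht0, integral_fromBlocks_diagonal, hsmean]
    simp
  have hS₀frob : frobSq S₀ = 2 / d := by
    rw [hS₀, frobSq_smul, frobSq_fromBlocks, Complex.norm_real, Real.norm_eq_abs, sq_abs, ht2, hstr,
      frobSq_eq_zero.mpr rfl]
    ring
  have hS₀cov : S₀ * S₀.conjTranspose = Matrix.fromBlocks ((d : ℂ)⁻¹ • reducedMatrix ρ e) 0 0
      ((d : ℂ)⁻¹ • reducedMatrix ρ e) := by
    have htc : (t : ℂ) * (t : ℂ) = (d : ℂ)⁻¹ := by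
      rw [← Complex.ofReal_mul, ← sq, ht2]
      simp
    rw [hS₀, Matrix.conjTranspose_smul, Matrix.smul_mul, Matrix.mul_smul, smul_smul,
      Complex.star_def, Complex.conj_ofReal, htc, Matrix.fromBlocks_conjTranspose,
      Matrix.fromBlocks_multiply, Matrix.fromBlocks_smul]
    simp [hsσ]
  have hterm : ∀ m m', ∫ ψ, h c (fun k => inner ℂ (w m m' k) ψ) ∂ρ.gaussian
      ≤ η * (4 / d ^ 2) + C * deviation ρ e B m m' := by
    intro m m'
    obtain ⟨S, hS⟩ := exists_square_root (ρ.innerMatrix (w m m'))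
    rw [DensityMatrix.integral_gaussian_inner _ _ hhc, ← integral_mulVec_eq hS hhc]
    have h1 := (le_abs_self _).trans (hC c hcM S S₀)
    rw [hS₀int, sub_zero, hS₀frob, div_pow] at h1
    refine h1.trans (le_of_eq ?_)
    congr 1
    · norm_num
    · congr 1
      have h2 : S * S.conjTranspose = Matrix.fromBlocks (block ρ e (B m) (B m))
          (block ρ e (B m) (B m')) (block ρ e (B m') (B m)) (block ρ e (B m') (B m')) := by
        rw [hS]
        ext k l
        rw [DensityMatrix.innerMatrix_mul_conjTranspose]
        rcases k with k | k <;> rcases l with l | l <;> rfl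
      have h3 : S * S.conjTranspose - S₀ * S₀.conjTranspose =
          Matrix.fromBlocks (block ρ e (B m) (B m) - (d : ℂ)⁻¹ • reducedMatrix ρ e)
          (block ρ e (B m) (B m')) (block ρ e (B m') (B m))
          (block ρ e (B m') (B m') - (d : ℂ)⁻¹ • reducedMatrix ρ e) := by
        rw [h2, hS₀cov]
        ext k l
        rcases k with k | k <;> rcases l with l | l <;> simp
      rw [h3, frobSq_fromBlocks, deviation]
  -- There are d² pairs and `frobSq S₀ ^ 2` is 4/d², so the η-terms add up to 4η whatever d is.
  calc _ ≤ ∑ m : Fin d, ∑ m' : Fin d, (η * (4 / d ^ 2) + C * deviation ρ e B m m') :=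
        Finset.sum_le_sum fun m _ => Finset.sum_le_sum fun m' _ => hterm m m'
    _ = _ := by
        simp only [Finset.sum_add_distrib, Finset.sum_const, Finset.card_univ, Fintype.card_fin,
          nsmul_eq_mul, Finset.mul_sum]
        congr 1
        field_simp

end SecondMomentBound

/-! ### Averaging the deviations over the basis -/

section RandomBasis

lemma sum_swap_outer {α β γ ζ : Type*} [Fintype α] [Fintype β] [Fintype γ] [Fintype ζ]
    (f : α → β → γ → ζ → ℝ) :
    ∑ a, ∑ b, ∑ c, ∑ z, f a b c z = ∑ z, ∑ b, ∑ c, ∑ a, f a b c z := by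
  calc ∑ a, ∑ b, ∑ c, ∑ z, f a b c z = ∑ a, ∑ x : β × γ, ∑ z, f a x.1 x.2 z := by
        simp only [Fintype.sum_prod_type]
    _ = ∑ a, ∑ z, ∑ x : β × γ, f a x.1 x.2 z := Finset.sum_congr rfl fun _ _ => Finset.sum_comm
    _ = ∑ z, ∑ a, ∑ x : β × γ, f a x.1 x.2 z := Finset.sum_comm
    _ = ∑ z, ∑ x : β × γ, ∑ a, f a x.1 x.2 z := Finset.sum_congr rfl fun _ _ => Finset.sum_comm
    _ = _ := by simp only [Fintype.sum_prod_type]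

variable {ι : Type*} [Fintype ι] {Ha Hb : Type*} [NormedAddCommGroup Ha] [InnerProductSpace ℂ Ha]
  [NormedAddCommGroup Hb] [InnerProductSpace ℂ Hb] [FiniteDimensional ℂ Ha] [FiniteDimensional ℂ Hb]

/-- The operator `⟨i|ρ|j⟩` on `Hb`. -/
def crossOp (ρ : DensityMatrix (Ha ⊗[ℂ] Hb)) (e : OrthonormalBasis ι ℂ Ha) (i j : ι) : Hb →ₗ[ℂ] Hb :=
  (TensorProduct.mk ℂ Ha Hb (e i)).adjoint ∘ₗ (ρ.op : Ha ⊗[ℂ] Hb →ₗ[ℂ] Ha ⊗[ℂ] Hb) ∘ₗ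
    TensorProduct.mk ℂ Ha Hb (e j)

lemma inner_crossOp (ρ : DensityMatrix (Ha ⊗[ℂ] Hb)) (e : OrthonormalBasis ι ℂ Ha) (i j : ι)
    (y y' : Hb) : inner ℂ y (crossOp ρ e i j y') = block ρ e y y' i j := by
  rw [crossOp, LinearMap.comp_apply, LinearMap.adjoint_inner_right]
  rfl

lemma trace_crossOp (ρ : DensityMatrix (Ha ⊗[ℂ] Hb)) (e : OrthonormalBasis ι ℂ Ha) (i j : ι) :
    LinearMap.trace ℂ Hb (crossOp ρ e i j) = reducedMatrix ρ e i j := by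
  rw [LinearMap.trace_eq_sum_inner _ (stdOrthonormalBasis ℂ Hb)]
  simp_rw [inner_crossOp]
  exact (inner_partialTrace _ _ _).symm

/-- Both sides add the squared entries of ρ in the product basis, so the total does not depend on
the basis of `Hb`. -/
lemma sum_frobSq_block {ι' : Type*} [Fintype ι'] (ρ : DensityMatrix (Ha ⊗[ℂ] Hb))
    (e : OrthonormalBasis ι ℂ Ha) (B : OrthonormalBasis ι' ℂ Hb) :
    ∑ m, ∑ m', frobSq (block ρ e (B m) (B m'))
      = hsSq (ρ.op : Ha ⊗[ℂ] Hb →ₗ[ℂ] Ha ⊗[ℂ] Hb) := by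
  rw [hsSq_eq_sum _ (e.tensorProduct B)]
  simp_rw [← (e.tensorProduct B).sum_sq_norm_inner_right, Fintype.sum_prod_type]
  simp only [frobSq, block, Matrix.of_apply, OrthonormalBasis.tensorProduct_apply,
    ContinuousLinearMap.coe_coe]
  exact sum_swap_outer _

lemma sum_hsSq_crossOp (ρ : DensityMatrix (Ha ⊗[ℂ] Hb)) (e : OrthonormalBasis ι ℂ Ha) :
    ∑ i, ∑ j, hsSq (crossOp ρ e i j) = hsSq (ρ.op : Ha ⊗[ℂ] Hb →ₗ[ℂ] Ha ⊗[ℂ] Hb) := by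
  rw [← sum_frobSq_block ρ e (stdOrthonormalBasis ℂ Hb)]
  simp_rw [hsSq_eq_sum _ (stdOrthonormalBasis ℂ Hb),
    ← (stdOrthonormalBasis ℂ Hb).sum_sq_norm_inner_right, inner_crossOp, frobSq]
  rw [sum_swap_outer]
  refine Finset.sum_congr rfl fun m _ => ?_
  rw [Finset.sum_comm]
  exact Finset.sum_congr rfl fun m' _ => Finset.sum_comm

/-- Each diagonal deviation occurs d times in either slot; the cross blocks, in both orders, exhaust
the entries of ρ twice. -/
lemma sum_deviation_eq (ρ : DensityMatrix (Ha ⊗[ℂ] Hb)) (e : OrthonormalBasis ι ℂ Ha) {d : ℕ}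
    (B : OrthonormalBasis (Fin d) ℂ Hb) :
    ∑ m, ∑ m', deviation ρ e B m m'
      = 2 * d * ∑ m, frobSq (block ρ e (B m) (B m) - (d : ℂ)⁻¹ • reducedMatrix ρ e)
        + 2 * hsSq (ρ.op : Ha ⊗[ℂ] Hb →ₗ[ℂ] Ha ⊗[ℂ] Hb) := by
  have h1 := sum_frobSq_block ρ e B
  have h2 := h1
  rw [Finset.sum_comm] at h2
  simp only [deviation, Finset.sum_add_distrib, h1, h2, Finset.sum_const, Finset.card_univ,
    Fintype.card_fin, nsmul_eq_mul, ← Finset.mul_sum]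
  ring

variable [CompleteSpace Hb]

/-- Each entry of the block is the quadratic form of a `crossOp` at an isotropic vector, with mean
the entry of the reduced matrix over d. The variance bounds add up to the Hilbert–Schmidt norm of ρ.
-/
lemma integral_frobSq_block_sub_le (ρ : DensityMatrix (Ha ⊗[ℂ] Hb)) (e : OrthonormalBasis ι ℂ Ha)
    (m : Fin (Module.finrank ℂ Hb)) :
    Integrable (fun B => frobSq (block ρ e (B m) (B m)
      - ((Module.finrank ℂ Hb : ℕ) : ℂ)⁻¹ • reducedMatrix ρ e)) (uONB Hb) ∧
    ∫ B, frobSq (block ρ e (B m) (B m)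
      - ((Module.finrank ℂ Hb : ℕ) : ℂ)⁻¹ • reducedMatrix ρ e) ∂uONB Hb
      ≤ 2 * ‖ρ.op‖ / (Module.finrank ℂ Hb : ℝ) ^ 2 := by
  have hiso := isIsotropic_uONB (E := Hb) m
  have hfrob : ∀ B : OrthonormalBasis (Fin (Module.finrank ℂ Hb)) ℂ Hb,
      frobSq (block ρ e (B m) (B m) - ((Module.finrank ℂ Hb : ℕ) : ℂ)⁻¹ • reducedMatrix ρ e)
      = ∑ i, ∑ j, ‖inner ℂ (B m) (crossOp ρ e i j (B m))
        - LinearMap.trace ℂ Hb (crossOp ρ e i j) / (Module.finrank ℂ Hb : ℕ)‖ ^ 2 := by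
    intro B
    simp_rw [frobSq, inner_crossOp, trace_crossOp, Matrix.sub_apply, Matrix.smul_apply, smul_eq_mul,
      inv_mul_eq_div]
  have hint : ∀ i j, Integrable (fun B : OrthonormalBasis (Fin (Module.finrank ℂ Hb)) ℂ Hb =>
      ‖inner ℂ (B m) (crossOp ρ e i j (B m))
        - LinearMap.trace ℂ Hb (crossOp ρ e i j) / (Module.finrank ℂ Hb : ℕ)‖ ^ 2) (uONB Hb) := by
    intro i j
    have hA : Continuous (crossOp ρ e i j) := (crossOp ρ e i j).continuous_of_finiteDimensional
    exact hiso.integrable_comp (h := fun x => ‖inner ℂ x (crossOp ρ e i j x)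
      - LinearMap.trace ℂ Hb (crossOp ρ e i j) / (Module.finrank ℂ Hb : ℕ)‖ ^ 2)
      (((continuous_id.inner hA).sub continuous_const).norm.pow 2)
  simp_rw [hfrob]
  refine ⟨integrable_finsetSum _ fun i _ => integrable_finsetSum _ fun j _ => hint i j, ?_⟩
  rw [integral_finsetSum _ fun i _ => integrable_finsetSum _ fun j _ => hint i j]
  simp_rw [integral_finsetSum _ fun j _ => hint _ j]
  calc _ ≤ ∑ i, ∑ j, 2 * hsSq (crossOp ρ e i j) / (Module.finrank ℂ Hb : ℝ) ^ 2 :=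
        Finset.sum_le_sum fun i _ => Finset.sum_le_sum fun j _ => hiso.integral_norm_sq_sub_le _
    _ = 2 * hsSq (ρ.op : Ha ⊗[ℂ] Hb →ₗ[ℂ] Ha ⊗[ℂ] Hb) / (Module.finrank ℂ Hb : ℝ) ^ 2 := by
        rw [← sum_hsSq_crossOp ρ e, Finset.mul_sum, Finset.sum_div]
        simp_rw [Finset.mul_sum, Finset.sum_div]
    _ ≤ _ := by
        gcongr
        exact ρ.hsSq_op_le

/-- For a uniformly random basis, the expected total deviation is bounded by the largest eigenvalue
of the density matrix. -/
lemma integral_sum_deviation_le (ρ : DensityMatrix (Ha ⊗[ℂ] Hb)) (e : OrthonormalBasis ι ℂ Ha) :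
    Integrable (fun B : OrthonormalBasis (Fin (Module.finrank ℂ Hb)) ℂ Hb =>
      ∑ m, ∑ m', deviation ρ e B m m') (uONB Hb) ∧
    ∫ B, ∑ m, ∑ m', deviation ρ e B m m' ∂uONB Hb ≤ 6 * ‖ρ.op‖ := by
  simp_rw [sum_deviation_eq]
  have hi := fun m => (integral_frobSq_block_sub_le ρ e m).1
  have hi2 := (integrable_finsetSum Finset.univ fun m _ => hi m).const_mul
    (2 * ((Module.finrank ℂ Hb : ℕ) : ℝ))
  refine ⟨hi2.add (integrable_const _), ?_⟩
  rw [integral_add hi2 (integrable_const _), integral_const_mul, integral_finsetSum _ fun m _ => hi m,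
    integral_const, probReal_univ, one_smul]
  have h1 : ∑ m, ∫ B, frobSq (block ρ e (B m) (B m)
      - ((Module.finrank ℂ Hb : ℕ) : ℂ)⁻¹ • reducedMatrix ρ e) ∂uONB Hb
      ≤ ∑ _m : Fin (Module.finrank ℂ Hb), 2 * ‖ρ.op‖ / (Module.finrank ℂ Hb : ℝ) ^ 2 :=
    Finset.sum_le_sum fun m _ => (integral_frobSq_block_sub_le ρ e m).2
  rw [Finset.sum_const, Finset.card_univ, Fintype.card_fin, nsmul_eq_mul] at h1
  have h2 := ρ.hsSq_op_le
  -- The diagonal blocks give 4‖ρ‖, the cross blocks 2‖ρ‖: hence 6.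
  have h3 : 2 * ((Module.finrank ℂ Hb : ℕ) : ℝ) * (((Module.finrank ℂ Hb : ℕ) : ℝ)
      * (2 * ‖ρ.op‖ / (Module.finrank ℂ Hb : ℝ) ^ 2)) ≤ 4 * ‖ρ.op‖ := by
    rcases Nat.eq_zero_or_pos (Module.finrank ℂ Hb) with h0 | h0
    · rw [h0]
      simp
    · have : (0 : ℝ) < Module.finrank ℂ Hb := by exact_mod_cast h0
      apply le_of_eq
      field_simp
      ring
  have h4 := mul_le_mul_of_nonneg_left h1
    (by positivity : 0 ≤ 2 * ((Module.finrank ℂ Hb : ℕ) : ℝ))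
  linarith

end RandomBasis

/-! ### Normalization and extension by degree 2 -/

section Normalization

variable {H : Type*} [NormedAddCommGroup H] [NormedSpace ℂ H]

/-- The normalization `ψ ↦ ψ / ‖ψ‖`. -/
def unitize (ψ : H) : H := ((‖ψ‖⁻¹ : ℝ) : ℂ) • ψ

lemma norm_unitize {ψ : H} (hψ : ψ ≠ 0) : ‖unitize ψ‖ = 1 := by
  have : ‖ψ‖ ≠ 0 := norm_ne_zero_iff.mpr hψ
  rw [unitize, norm_smul, Complex.norm_real, norm_inv, norm_norm, inv_mul_cancel₀ this]

lemma norm_unitize_le (ψ : H) : ‖unitize ψ‖ ≤ 1 := by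
  rcases eq_or_ne ψ 0 with rfl | hψ
  · simp [unitize]
  · exact (norm_unitize hψ).le

/-- Since `‖0‖⁻¹ = 0`, the zero vector is sent to itself and misses the sphere. -/
lemma preimage_unitize_sphere :
    unitize ⁻¹' Metric.sphere (0 : H) 1 = {0}ᶜ := by
  ext ψ
  rcases eq_or_ne ψ 0 with rfl | hψ
  · simp [unitize]
  · simp [norm_unitize hψ, hψ]

lemma unitize_smul {t : ℝ} (ht : 0 < t) (ψ : H) : unitize (t • ψ) = unitize ψ := by
  rw [unitize, unitize, norm_smul, Real.norm_eq_abs, abs_of_pos ht,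
    show t • ψ = (t : ℂ) • ψ from rfl, smul_smul, ← Complex.ofReal_mul]
  congr 2
  field_simp

/-- The extension of a function on the sphere to a function of degree `2`. -/
def quadExt (F : H → ℝ) (ψ : H) : ℝ := ‖ψ‖ ^ 2 * F (unitize ψ)

lemma quadExt_smul (F : H → ℝ) {t : ℝ} (ht : 0 ≤ t) (ψ : H) :
    quadExt F (t • ψ) = t ^ 2 * quadExt F ψ := by
  rcases ht.eq_or_lt with rfl | ht
  · simp [quadExt]
  · rw [quadExt, quadExt, unitize_smul ht, norm_smul, Real.norm_eq_abs, abs_of_pos ht]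
    ring

lemma abs_quadExt_le {F : H → ℝ} {M : ℝ} (hM : ∀ x, ‖x‖ ≤ 1 → |F x| ≤ M) (ψ : H) :
    |quadExt F ψ| ≤ M * ‖ψ‖ ^ 2 := by
  rw [quadExt, abs_mul, abs_of_nonneg (by positivity), mul_comm]
  exact mul_le_mul_of_nonneg_right (hM _ (norm_unitize_le ψ)) (by positivity)

/-- Although `unitize` is discontinuous at 0, the factor ‖ψ‖² forces the limit 0 there. -/
lemma continuous_quadExt {F : H → ℝ} (hF : Continuous F) {M : ℝ}
    (hM : ∀ x, ‖x‖ ≤ 1 → |F x| ≤ M) : Continuous (quadExt F) := by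
  rw [continuous_iff_continuousAt]
  intro ψ
  rcases eq_or_ne ψ 0 with rfl | hψ
  · have h0 : quadExt F 0 = 0 := by simp [quadExt]
    rw [ContinuousAt, h0]
    refine squeeze_zero_norm (fun x => abs_quadExt_le hM x) ?_
    have : Continuous fun x : H => M * ‖x‖ ^ 2 := by fun_prop
    simpa using this.tendsto 0
  · have h1 : ContinuousAt (unitize : H → H) ψ :=
      (Complex.continuous_ofReal.continuousAt.comp
        (continuous_norm.continuousAt.inv₀ (norm_ne_zero_iff.mpr hψ))).smul continuousAt_id
    exact (continuous_norm.continuousAt.pow 2).mul (hF.continuousAt.comp h1)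

variable [MeasurableSpace H] [BorelSpace H] [SecondCountableTopology H]

lemma measurable_unitize : Measurable (unitize : H → H) := by
  unfold unitize; fun_prop

lemma integral_normalizeToSphere (ν : Measure H) {F : H → ℝ} (hF : Continuous F) :
    ∫ φ, F (φ : H) ∂normalizeToSphere ν = ∫ ψ, ({0}ᶜ : Set H).indicator (F ∘ unitize) ψ ∂ν := by
  have hs : MeasurableSet (Metric.sphere (0 : H) 1) := Metric.isClosed_sphere.measurableSet
  rw [normalizeToSphere, integral_subtype_comap hs, integral_indicator
    (MeasurableSet.singleton 0).compl, ← preimage_unitize_sphere]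
  exact setIntegral_map hs hF.aestronglyMeasurable measurable_unitize.aemeasurable

lemma lintegral_normalizeToSphere (ν : Measure H) {F : H → ENNReal} (hF : Measurable F) :
    ∫⁻ φ, F (φ : H) ∂normalizeToSphere ν = ∫⁻ ψ, ({0}ᶜ : Set H).indicator (F ∘ unitize) ψ ∂ν := by
  have hs : MeasurableSet (Metric.sphere (0 : H) 1) := Metric.isClosed_sphere.measurableSet
  rw [normalizeToSphere, lintegral_subtype_comap hs, lintegral_indicator
    (MeasurableSet.singleton 0).compl, ← preimage_unitize_sphere]
  exact setLIntegral_map hs hF measurable_unitize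

end Normalization

namespace DensityMatrix

variable {H : Type*} [NormedAddCommGroup H] [InnerProductSpace ℂ H] [FiniteDimensional ℂ H]
  [MeasurableSpace H] [BorelSpace H]

lemma lintegral_gap (ρ : DensityMatrix H) {F : H → ENNReal} (hF : Measurable F) :
    ∫⁻ φ, F (φ : H) ∂ρ.gap
      = ∫⁻ ψ, ENNReal.ofReal (‖ψ‖ ^ 2) * F (unitize ψ) ∂ρ.gaussian := by
  have : ProperSpace H := FiniteDimensional.proper ℂ H
  rw [gap, lintegral_normalizeToSphere _ hF, adjustedGaussian,
    lintegral_withDensity_eq_lintegral_mul _ (by fun_prop)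
      ((hF.comp measurable_unitize).indicator (MeasurableSet.singleton 0).compl)]
  refine lintegral_congr fun ψ => ?_
  rcases eq_or_ne ψ 0 with rfl | hψ
  · simp
  · simp [hψ]

/-- The density of GA(ρ) is exactly the factor in `quadExt`; it also vanishes at 0, so the excluded
zero vector costs nothing. -/
lemma integral_gap (ρ : DensityMatrix H) {F : H → ℝ} (hF : Continuous F) :
    ∫ φ, F (φ : H) ∂ρ.gap = ∫ ψ, quadExt F ψ ∂ρ.gaussian := by
  have : ProperSpace H := FiniteDimensional.proper ℂ H
  rw [gap, integral_normalizeToSphere _ hF, adjustedGaussian,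
    integral_withDensity_eq_integral_toReal_smul (by fun_prop) (by simp)]
  refine integral_congr_ae (ae_of_all _ fun ψ => ?_)
  rcases eq_or_ne ψ 0 with rfl | hψ
  · simp [quadExt]
  · simp [hψ, quadExt]

instance (ρ : DensityMatrix H) : IsProbabilityMeasure ρ.gap := by
  refine ⟨?_⟩
  have h := ρ.lintegral_gap (F := fun _ => 1) measurable_const
  simp only [lintegral_const, one_mul, mul_one] at h
  rw [h, ← ofReal_integral_eq_lintegral_ofReal ρ.integrable_norm_sq_gaussian
    (ae_of_all _ fun _ => by positivity), integral_norm_sq_gaussian, ENNReal.ofReal_one]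

lemma integrable_quadExt (ρ : DensityMatrix H) {F : H → ℝ} (hF : Continuous F) {M : ℝ}
    (hM : ∀ x, ‖x‖ ≤ 1 → |F x| ≤ M) : Integrable (quadExt F) ρ.gaussian := by
  have : ProperSpace H := FiniteDimensional.proper ℂ H
  exact (ρ.integrable_norm_sq_gaussian.const_mul M).mono'
    (continuous_quadExt hF hM).aestronglyMeasurable (ae_of_all _ fun ψ => abs_quadExt_le hM ψ)

end DensityMatrix

/-! ### Born means as sums over the basis -/

section Born

variable {Ha Hb : Type*} [NormedAddCommGroup Ha] [InnerProductSpace ℂ Ha]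
  [NormedAddCommGroup Hb] [InnerProductSpace ℂ Hb]

lemma sum_inner_smul_eq_partialInner {ι : Type*} [Fintype ι] (e : OrthonormalBasis ι ℂ Ha) (y : Hb) (ψ : Ha ⊗[ℂ] Hb) :
    ∑ i, inner ℂ (e i ⊗ₜ[ℂ] y) ψ • e i = partialInner y ψ := by
  rw [← e.sum_repr' (partialInner y ψ)]
  simp_rw [inner_partialInner]

variable [FiniteDimensional ℂ Ha]

/-- The probability of the index m is the factor ‖⟨m|ψ⟩‖² of `quadExt`; indices with zero vector
contribute nothing to either side. -/
lemma integral_born [MeasurableSpace Ha] [BorelSpace Ha] {d : ℕ} (ψ : Ha ⊗[ℂ] Hb)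
    (B : OrthonormalBasis (Fin d) ℂ Hb) {F : Ha → ℝ} (hF : Continuous F) :
    ∫ φ, F (φ : Ha) ∂born ψ B = ∑ m, quadExt F (partialInner (B m) ψ) := by
  have : ProperSpace Ha := FiniteDimensional.proper ℂ Ha
  have hm : Measurable (({0}ᶜ : Set Ha).indicator (F ∘ unitize)) :=
    (hF.measurable.comp measurable_unitize).indicator (MeasurableSet.singleton 0).compl
  rw [born, integral_normalizeToSphere _ hF, integral_map (measurable_of_finite _).aemeasurable
    hm.aestronglyMeasurable, indexLaw, Measure.sum_fintype, integral_finsetSum_measure]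
  · refine Finset.sum_congr rfl fun m _ => ?_
    rw [integral_smul_measure, integral_dirac, ENNReal.toReal_ofReal (by positivity), smul_eq_mul]
    rcases eq_or_ne (partialInner (B m) ψ) 0 with h0 | h0
    · simp [quadExt, h0]
    · simp [quadExt, h0]
  · intro m _
    exact Integrable.smul_measure (integrable_dirac (by simp)) ENNReal.ofReal_ne_top

lemma sum_norm_partialInner_sq {d : ℕ} (ψ : Ha ⊗[ℂ] Hb) (B : OrthonormalBasis (Fin d) ℂ Hb) :
    ∑ m, ‖partialInner (B m) ψ‖ ^ 2 = ‖ψ‖ ^ 2 := by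
  rw [← ((stdOrthonormalBasis ℂ Ha).tensorProduct B).sum_sq_norm_inner_right,
    Fintype.sum_prod_type_right]
  refine Finset.sum_congr rfl fun m _ => ?_
  rw [← (stdOrthonormalBasis ℂ Ha).sum_sq_norm_inner_right]
  simp_rw [inner_partialInner, OrthonormalBasis.tensorProduct_apply]

variable [FiniteDimensional ℂ Hb]

lemma continuous_partialInner_apply (m : Fin (Module.finrank ℂ Hb)) :
    Continuous fun x : Metric.sphere (0 : Ha ⊗[ℂ] Hb) 1 ×
      OrthonormalBasis (Fin (Module.finrank ℂ Hb)) ℂ Hb => partialInner (x.2 m) (x.1 : Ha ⊗[ℂ] Hb) := by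
  simp_rw [← sum_inner_smul_eq_partialInner (stdOrthonormalBasis ℂ Ha)]
  refine continuous_finsetSum _ fun i _ => ?_
  have h : Continuous fun x : Metric.sphere (0 : Ha ⊗[ℂ] Hb) 1 ×
      OrthonormalBasis (Fin (Module.finrank ℂ Hb)) ℂ Hb =>
      TensorProduct.mk ℂ Ha Hb (stdOrthonormalBasis ℂ Ha i) (x.2 m) :=
    (TensorProduct.mk ℂ Ha Hb
      (stdOrthonormalBasis ℂ Ha i)).continuous_of_finiteDimensional.comp
      ((continuous_orthonormalBasis_apply m).comp continuous_snd)
  exact (h.inner (continuous_subtype_val.comp continuous_fst)).smul continuous_const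

end Born

/-! ### Chebyshev's inequality under size bias -/

section Chebyshev

variable {Ha Hb : Type*} [NormedAddCommGroup Ha] [InnerProductSpace ℂ Ha] [FiniteDimensional ℂ Ha]
  [NormedAddCommGroup Hb] [InnerProductSpace ℂ Hb] [FiniteDimensional ℂ Hb]

/-- Chebyshev's inequality for the size-biased law `GAP(ρ)`, for a fixed basis. -/
lemma gap_setOf_le (ρ : DensityMatrix (Ha ⊗[ℂ] Hb)) {F : Ha → ℝ} (hF : Continuous F) {M : ℝ}
    (hM : ∀ x, ‖x‖ ≤ 1 → |F x| ≤ M) {d : ℕ} (B : OrthonormalBasis (Fin d) ℂ Hb) (c : ℝ)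
    {ε δ K : ℝ} (hε : 0 < ε) (hδ : 0 < δ)
    (hint : Integrable (fun ψ => (∑ m, quadExt F (partialInner (B m) ψ) - c * ‖ψ‖ ^ 2) ^ 2)
      ρ.gaussian)
    (hK : ∫ ψ, (∑ m, quadExt F (partialInner (B m) ψ) - c * ‖ψ‖ ^ 2) ^ 2 ∂ρ.gaussian ≤ K) :
    ρ.gap {φ | ε ≤ |∑ m, quadExt F (partialInner (B m) (φ : Ha ⊗[ℂ] Hb)) - c|}
      ≤ ENNReal.ofReal (δ / 2 + K / (2 * δ * ε ^ 2)) := by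
  have hcont : Continuous fun ψ : Ha ⊗[ℂ] Hb => ∑ m, quadExt F (partialInner (B m) ψ) :=
    continuous_finsetSum _ fun m _ => (continuous_quadExt hF hM).comp
      (partialInner (B m)).continuous_of_finiteDimensional
  let A : Set (Ha ⊗[ℂ] Hb) := {ψ | ε ≤ |∑ m, quadExt F (partialInner (B m) ψ) - c|}
  have hA : MeasurableSet A :=
    (isClosed_le continuous_const (hcont.sub continuous_const).abs).measurableSet
  have hset : ρ.gap {φ | ε ≤ |∑ m, quadExt F (partialInner (B m) (φ : Ha ⊗[ℂ] Hb)) - c|}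
      = ∫⁻ φ, A.indicator 1 (φ : Ha ⊗[ℂ] Hb) ∂ρ.gap :=
    (lintegral_indicator_one (measurable_subtype_coe hA)).symm
  rw [hset, ρ.lintegral_gap (measurable_one.indicator hA)]
  have hsmul : ∀ ψ : Ha ⊗[ℂ] Hb, ψ ≠ 0 → ∑ m, quadExt F (partialInner (B m) (unitize ψ))
      = (‖ψ‖ ^ 2)⁻¹ * ∑ m, quadExt F (partialInner (B m) ψ) := by
    intro ψ hψ
    rw [Finset.mul_sum]
    refine Finset.sum_congr rfl fun m _ => ?_
    have h1 : partialInner (B m) (unitize ψ) = ‖ψ‖⁻¹ • partialInner (B m) ψ := by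
      rw [unitize, map_smul]
      rfl
    rw [h1, quadExt_smul F (by positivity), inv_pow]
  have hint' : Integrable (fun ψ => δ / 2 + (∑ m, quadExt F (partialInner (B m) ψ)
      - c * ‖ψ‖ ^ 2) ^ 2 / (2 * δ * ε ^ 2)) ρ.gaussian :=
    (integrable_const _).add (hint.div_const _)
  calc ∫⁻ ψ, ENNReal.ofReal (‖ψ‖ ^ 2) * A.indicator 1 (unitize ψ) ∂ρ.gaussian
      ≤ ∫⁻ ψ, ENNReal.ofReal (δ / 2 + (∑ m, quadExt F (partialInner (B m) ψ) - c * ‖ψ‖ ^ 2) ^ 2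
          / (2 * δ * ε ^ 2)) ∂ρ.gaussian := by
        refine lintegral_mono fun ψ => ?_
        by_cases hψ : unitize ψ ∈ A
        · rcases eq_or_ne ψ 0 with rfl | hψ0
          · simp
          rw [Set.indicator_of_mem hψ, Pi.one_apply, mul_one]
          refine ENNReal.ofReal_le_ofReal ?_
          have hn : 0 < ‖ψ‖ ^ 2 := by positivity
          set X := ∑ m, quadExt F (partialInner (B m) ψ) with hX
          have h1 : ε ≤ |(‖ψ‖ ^ 2)⁻¹ * X - c| := by
            have : ε ≤ |∑ m, quadExt F (partialInner (B m) (unitize ψ)) - c| := hψ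
            rwa [hsmul ψ hψ0] at this
          have h2 : ε * ‖ψ‖ ^ 2 ≤ |X - c * ‖ψ‖ ^ 2| := by
            have h3 : X - c * ‖ψ‖ ^ 2 = ((‖ψ‖ ^ 2)⁻¹ * X - c) * ‖ψ‖ ^ 2 := by
              field_simp
            rw [h3, abs_mul, abs_of_pos hn]
            exact mul_le_mul_of_nonneg_right h1 hn.le
          -- AM–GM: 2δε·ε‖ψ‖² ≤ 2δε|X − c‖ψ‖²| ≤ (δε)² + (X − c‖ψ‖²)². No control of the law of ‖ψ‖
          -- is needed.
          have h4 : δ / 2 + (X - c * ‖ψ‖ ^ 2) ^ 2 / (2 * δ * ε ^ 2)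
              = ((δ * ε) ^ 2 + |X - c * ‖ψ‖ ^ 2| ^ 2) / (2 * δ * ε ^ 2) := by
            rw [sq_abs]
            field_simp
          rw [h4, le_div_iff₀ (by positivity)]
          have h5 := mul_le_mul_of_nonneg_left h2 (by positivity : 0 ≤ 2 * δ * ε)
          nlinarith [sq_nonneg (δ * ε - |X - c * ‖ψ‖ ^ 2|)]
        · rw [Set.indicator_of_notMem hψ, mul_zero]
          exact zero_le
    _ = ENNReal.ofReal (∫ ψ, (δ / 2 + (∑ m, quadExt F (partialInner (B m) ψ) - c * ‖ψ‖ ^ 2) ^ 2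
          / (2 * δ * ε ^ 2)) ∂ρ.gaussian) := by
        rw [ofReal_integral_eq_lintegral_ofReal hint' (ae_of_all _ fun ψ => by positivity)]
    _ ≤ _ := by
        refine ENNReal.ofReal_le_ofReal ?_
        rw [integral_add (integrable_const _) (hint.div_const _), integral_const, probReal_univ,
          one_smul, integral_div]
        gcongr

end Chebyshev

/-! ### Mean square fluctuation of the Born mean -/

section Concentration

variable {Ha : Type u} [NormedAddCommGroup Ha] [InnerProductSpace ℂ Ha] [FiniteDimensional ℂ Ha]
  [MeasurableSpace Ha] [BorelSpace Ha]

/-- The mean square of the fluctuation `∑ m, g (⟨m|Ψ⟩) - c ‖Ψ‖²` of the extension `g` of `F` around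
the mean `c` of `F`. -/
lemma exists_integral_fluctuation_sq_le {F : Ha → ℝ} (hF : Continuous F) {M : ℝ}
    (hM : ∀ x, ‖x‖ ≤ 1 → |F x| ≤ M) {η : ℝ} (hη : 0 < η) :
    ∃ C, 0 ≤ C ∧ ∀ (Hb : Type v) [NormedAddCommGroup Hb] [InnerProductSpace ℂ Hb]
      [FiniteDimensional ℂ Hb] (ρ : DensityMatrix (Ha ⊗[ℂ] Hb)) (d : ℕ)
      (B : OrthonormalBasis (Fin d) ℂ Hb),
      Integrable (fun ψ => (∑ m, quadExt F (partialInner (B m) ψ)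
        - (∫ φ, F (φ : Ha) ∂ρ.reduced.gap) * ‖ψ‖ ^ 2) ^ 2) ρ.gaussian ∧
      ∫ ψ, (∑ m, quadExt F (partialInner (B m) ψ)
        - (∫ φ, F (φ : Ha) ∂ρ.reduced.gap) * ‖ψ‖ ^ 2) ^ 2 ∂ρ.gaussian
        ≤ η * 4 + C * ∑ m, ∑ m', deviation ρ (stdOrthonormalBasis ℂ Ha) B m m' := by
  set e := stdOrthonormalBasis ℂ Ha
  have hq := continuous_quadExt hF hM
  -- The term with `c` centres the function, as ‖φ‖² has Gaussian mean 1; summed over a basis it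
  -- becomes c‖ψ‖².
  let G : ℝ → (Fin (Module.finrank ℂ Ha) → ℂ) → ℝ := fun c w =>
    quadExt F (∑ i, w i • e i) - c * ‖∑ i, w i • e i‖ ^ 2
  have hGc : Continuous fun p : ℝ × (Fin (Module.finrank ℂ Ha) → ℂ) => G p.1 p.2 :=
    (hq.comp (by fun_prop)).sub (by fun_prop)
  have hGh : ∀ c (t : ℝ) v, 0 ≤ t → G c (t • v) = t ^ 2 * G c v := by
    intro c t v ht
    have h1 : ∑ i, (t • v) i • e i = t • ∑ i, v i • e i := by
      rw [Finset.smul_sum]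
      exact Finset.sum_congr rfl fun i _ => by rw [Pi.smul_apply, smul_assoc]
    simp only [G]
    rw [h1, quadExt_smul F ht, norm_smul, Real.norm_eq_abs, abs_of_nonneg ht]
    ring
  obtain ⟨C, hC0, hC⟩ := exists_integral_sum_sq_le.{u, v} e hGc hGh M hη
  refine ⟨C, hC0, fun Hb _ _ _ ρ d B => ?_⟩
  set c := ∫ φ, F (φ : Ha) ∂ρ.reduced.gap with hc
  -- The centre depends on ρ, but this bound is uniform, so `C` may be chosen beforehand.
  have hcM : |c| ≤ M := by
    have := norm_integral_le_of_norm_le_const (μ := ρ.reduced.gap)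
      (f := fun φ => F (φ : Ha)) (C := M) (ae_of_all _ fun φ => hM φ (by simp))
    simpa using this
  have hmean : ∫ φ, G c (fun i => inner ℂ (e i) φ) ∂ρ.reduced.gaussian = 0 := by
    simp only [G, e.sum_repr']
    rw [integral_sub (ρ.reduced.integrable_quadExt hF hM)
      (ρ.reduced.integrable_norm_sq_gaussian.const_mul c), integral_const_mul,
      DensityMatrix.integral_norm_sq_gaussian, ← DensityMatrix.integral_gap _ hF, ← hc]
    ring
  have h := hC c hcM Hb ρ d B hmean
  have hG : ∀ ψ, ∑ m, G c (fun i => inner ℂ (e i ⊗ₜ[ℂ] B m) ψ)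
      = ∑ m, quadExt F (partialInner (B m) ψ) - c * ‖ψ‖ ^ 2 := by
    intro ψ
    simp only [G, sum_inner_smul_eq_partialInner]
    rw [Finset.sum_sub_distrib, ← Finset.mul_sum, sum_norm_partialInner_sq]
  simpa only [hG] using h

end Concentration

end QM

end

/-! ### The theorem: choice of constants and integration over the basis -/

theorem corollary4 {Ha : Type*} [NormedAddCommGroup Ha] [InnerProductSpace ℂ Ha]
    [FiniteDimensional ℂ Ha] [MeasurableSpace Ha] [BorelSpace Ha]
    (ε δ : ℝ) (hε : ε ∈ Set.Ioo (0 : ℝ) 1) (hδ : δ ∈ Set.Ioo (0 : ℝ) 1)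
    (f : Metric.sphere (0 : Ha) 1 → ℝ) (hf : Continuous f) :
    ∃ p : ℝ, 0 < p ∧
      ∀ (Hb : Type*) [NormedAddCommGroup Hb] [InnerProductSpace ℂ Hb] [CompleteSpace Hb]
        [FiniteDimensional ℂ Hb],
        max (max 4 (Module.finrank ℂ Ha : ℝ)) (32 * (⨆ φ, |f φ|) ^ 2 / (ε ^ 2 * δ)) ≤
          (Module.finrank ℂ Hb : ℝ) →
        ∀ ρ : QM.DensityMatrix (Ha ⊗[ℂ] Hb), ‖ρ.op‖ ≤ p →
          ENNReal.ofReal (1 - δ) ≤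
            (ρ.gap.prod (QM.uONB Hb))
              {x | |(∫ φ, f φ ∂(QM.born (x.1 : Ha ⊗[ℂ] Hb) x.2)) - ∫ φ, f φ ∂ρ.reduced.gap| < ε} := by
  have hε0 : 0 < ε := hε.1
  have hδ0 : 0 < δ := hδ.1
  have hproper : ProperSpace Ha := FiniteDimensional.proper ℂ Ha
  -- Tietze extension. The bound `M` is taken on the whole unit ball, because `unitize` takes the
  -- value 0 at 0.
  obtain ⟨F, hFf⟩ := ContinuousMap.exists_restrict_eq (Y := ℝ)
    (Metric.isClosed_sphere (x := (0 : Ha)) (ε := 1)) ⟨f, hf⟩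
  have hfF : ∀ φ, f φ = F (φ : Ha) := fun φ => (congrArg (fun g => g φ) hFf).symm
  obtain ⟨M, hM'⟩ := (isCompact_closedBall (0 : Ha) 1).exists_bound_of_continuousOn
    F.continuous.continuousOn
  have hM : ∀ x, ‖x‖ ≤ 1 → |F x| ≤ M := fun x hx => hM' x (by simpa using hx)
  -- With this η the term 4η is δ²ε²/2, and the p below makes 6Cp at most δ²ε²/2. The averaged
  -- second moment is then at most δ²ε², and the Chebyshev bound gives δ/2 + δ/2.
  obtain ⟨C, hC0, hC⟩ := QM.exists_integral_fluctuation_sq_le F.continuous hM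
    (by positivity : 0 < δ ^ 2 * ε ^ 2 / 8)
  refine ⟨δ ^ 2 * ε ^ 2 / (12 * (C + 1)), by positivity, fun Hb _ _ _ _ _ ρ hρ => ?_⟩
  simp_rw [hfF]
  set c := ∫ φ, F (φ : Ha) ∂ρ.reduced.gap with hc
  set S := {x : Metric.sphere (0 : Ha ⊗[ℂ] Hb) 1 ×
    OrthonormalBasis (Fin (Module.finrank ℂ Hb)) ℂ Hb |
    |(∫ φ, F (φ : Ha) ∂(QM.born (x.1 : Ha ⊗[ℂ] Hb) x.2)) - c| < ε} with hS
  have hSc : Sᶜ = {x | ε ≤ |∑ m, QM.quadExt F (QM.partialInner (x.2 m) (x.1 : Ha ⊗[ℂ] Hb)) - c|} := by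
    ext x
    simp only [hS, Set.mem_compl_iff, Set.mem_ofPred_eq, not_lt, QM.integral_born _ _ F.continuous]
  have hScm : MeasurableSet Sᶜ := by
    have : ProperSpace (Ha ⊗[ℂ] Hb) := FiniteDimensional.proper ℂ _
    rw [hSc]
    refine (isClosed_le continuous_const (Continuous.abs (Continuous.sub ?_
      continuous_const))).measurableSet
    exact continuous_finsetSum _ fun m _ =>
      (QM.continuous_quadExt F.continuous hM).comp (QM.continuous_partialInner_apply m)
  let dev : OrthonormalBasis (Fin (Module.finrank ℂ Hb)) ℂ Hb → ℝ := fun B =>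
    ∑ m, ∑ m', QM.deviation ρ (stdOrthonormalBasis ℂ Ha) B m m'
  have hdev0 : ∀ B, 0 ≤ dev B := fun B =>
    Finset.sum_nonneg fun m _ => Finset.sum_nonneg fun m' _ => QM.deviation_nonneg ρ _ B m m'
  obtain ⟨hdevi, hdev⟩ := QM.integral_sum_deviation_le ρ (stdOrthonormalBasis ℂ Ha)
  have hdevi' : Integrable dev (QM.uONB Hb) := hdevi
  have hint1 : Integrable (fun B => δ ^ 2 * ε ^ 2 / 8 * 4 + C * dev B) (QM.uONB Hb) :=
    (integrable_const _).add (hdevi.const_mul C)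
  have hint2 : Integrable (fun B => δ / 2 + (δ ^ 2 * ε ^ 2 / 8 * 4 + C * dev B)
      / (2 * δ * ε ^ 2)) (QM.uONB Hb) :=
    (integrable_const _).add (hint1.div_const _)
  have hbad : (ρ.gap.prod (QM.uONB Hb)) Sᶜ ≤ ENNReal.ofReal δ := by
    -- The basis is integrated last: the Chebyshev bound holds for each fixed basis, the deviation
    -- bound only on average over bases.
    rw [Measure.prod_apply_symm hScm]
    calc _ ≤ ∫⁻ B, ENNReal.ofReal (δ / 2 + (δ ^ 2 * ε ^ 2 / 8 * 4 + C * dev B)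
          / (2 * δ * ε ^ 2)) ∂QM.uONB Hb := by
          refine lintegral_mono fun B => ?_
          obtain ⟨h1, h2⟩ := hC Hb ρ _ B
          have h3 := QM.gap_setOf_le ρ F.continuous hM B c hε0 hδ0 h1 h2
          rw [hSc]
          exact h3
      _ = ENNReal.ofReal (∫ B, (δ / 2 + (δ ^ 2 * ε ^ 2 / 8 * 4 + C * dev B)
          / (2 * δ * ε ^ 2)) ∂QM.uONB Hb) := by
          rw [ofReal_integral_eq_lintegral_ofReal hint2
            (ae_of_all _ fun B => by
              have := hdev0 B
              positivity)]
      _ ≤ _ := by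
          refine ENNReal.ofReal_le_ofReal ?_
          rw [integral_add (integrable_const _) (hint1.div_const _), integral_const,
            probReal_univ, one_smul, integral_div, integral_add (integrable_const _)
            (hdevi'.const_mul C), integral_const, probReal_univ, one_smul, integral_const_mul]
          have h1 : C * ∫ B, dev B ∂QM.uONB Hb ≤ δ ^ 2 * ε ^ 2 / 2 := by
            have h2 : C * ∫ B, dev B ∂QM.uONB Hb
                ≤ C * (6 * (δ ^ 2 * ε ^ 2 / (12 * (C + 1)))) := by
              refine mul_le_mul_of_nonneg_left (hdev.trans ?_) hC0
              linarith
            refine h2.trans ?_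
            have h3 : C * (6 * (δ ^ 2 * ε ^ 2 / (12 * (C + 1))))
                = C / (C + 1) * (δ ^ 2 * ε ^ 2 / 2) := by
              field_simp
              ring
            rw [h3]
            have h4 : C / (C + 1) ≤ 1 := by
              rw [div_le_one (by positivity)]
              linarith
            nlinarith [(by positivity : 0 ≤ δ ^ 2 * ε ^ 2 / 2)]
          have h5 : (δ ^ 2 * ε ^ 2 / 8 * 4 + C * ∫ B, dev B ∂QM.uONB Hb) / (2 * δ * ε ^ 2)
              ≤ δ / 2 := by
            rw [div_le_iff₀ (by positivity)]
            nlinarith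
          linarith
  have htotal : (1 : ENNReal) ≤ (ρ.gap.prod (QM.uONB Hb)) S + (ρ.gap.prod (QM.uONB Hb)) Sᶜ := by
    rw [← measure_univ (μ := ρ.gap.prod (QM.uONB Hb)), ← Set.union_compl_self S]
    exact measure_union_le _ _
  rw [ENNReal.ofReal_sub _ hδ0.le, ENNReal.ofReal_one, tsub_le_iff_right]
  exact htotal.trans (by gcongr)
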